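/- **Theorem.** Let $A$ be a C*-algebra, let $G$ be a discrete group, and let $\alpha\colon G\to\mathrm{Aut}(A)$ be an action of $G$ on $A$ by *-automorphisms. If $\alpha$ has the Rokhlin* property, then $\alpha$ is properly outer. *Definitions.* Ideals are closed and two-sided. Put $A_\infty:=\ell^\infty(\mathbb N,A)/c_0(\mathbb N,A)$, with $A\subseteq A_\infty$ as the (classes of) constant sequences. The bidual $(A_\infty)^{**}$ is the enveloping von Neumann algebra of $A_\infty$; it contains $A\subseteq A_\infty\subseteq (A_\infty)^{**}$. The group $G$ acts on $A_\infty$ entrywise, and on $(A_\infty)^*$ and $(A_\infty)^{**}$ by $(t.\varphi)(b)=\varphi(t^{-1}.b)$ and $(t.x)(\varphi)=x(t^{-1}.\varphi)$. The action has the *Rokhlin\* property* if there is a projection $p_e\in A'\cap (A_\infty)^{**}$ such that 1. $p_e\,(t.p_e)=0$ for every $t\in G\setminus\{e\}$; 2. for every $a\in A$ with $a\neq 0$ there is $t\in G$ with $a\,(t.p_e)\neq 0$. The action is *properly outer* if, for every $t\in G\setminus\{e\}$, every nonzero ideal $I$ of $A$ that is invariant under the group $\langle\alpha_t\rangle$ generated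 by $\alpha_t$, and every unitary $u$ in the multiplier algebra $\mathcal M(I)$, $$\|\alpha_t|_I-\mathrm{Ad}(u)\|=2,$$ where $\mathrm{Ad}(u)(x)=uxu^*$ for $x\in I$ and the norm is the operator norm of bounded linear maps $I\to I$. -/

import Mathlib

open Filter Topology
open scoped ENNReal MultiplierAlgebra

noncomputable section

namespace RokhlinStar

/-! ### The sequence algebra `A_∞ = ℓ^∞(ℕ, A) / c₀(ℕ, A)` -/

section SeqAlg

/-- The space `ℓ^∞(A)` of bounded sequences in `A`, with the supremum norm and the
entrywise operations. -/
abbrev LInfty (A : Type*) [NonUnitalCStarAlgebra A] : Type _ := lp (fun _ : ℕ => A) ∞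

/-- The ideal `c₀(A)` of the sequences in `ℓ^∞(A)` whose norms tend to zero. -/
def cZero (A : Type*) [NonUnitalCStarAlgebra A] : Submodule ℂ (LInfty A) where
  carrier := {x | Tendsto (fun n => ‖x n‖) atTop (𝓝 0)}
  zero_mem' := by simp
  add_mem' := by
    intro x y hx hy
    refine squeeze_zero (fun n => norm_nonneg _) (fun n => ?_) (by simpa using hx.add hy)
    simpa using norm_add_le (x n) (y n)
  smul_mem' := by
    intro c x hx
    have : Tendsto (fun n => ‖c‖ * ‖x n‖) atTop (𝓝 0) := by simpa using hx.const_mul ‖c‖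
    refine this.congr fun n => ?_
    simp [norm_smul]

variable {A : Type*} [NonUnitalCStarAlgebra A]

theorem mem_cZero {x : LInfty A} : x ∈ cZero A ↔ Tendsto (fun n => ‖x n‖) atTop (𝓝 0) := Iff.rfl

instance isClosed_cZero : IsClosed (cZero A : Set (LInfty A)) := by
  refine isClosed_of_closure_subset fun x hx => ?_
  rw [SetLike.mem_coe, mem_cZero, Metric.tendsto_atTop]
  intro ε hε
  obtain ⟨y, hy, hxy⟩ := Metric.mem_closure_iff.1 hx (ε / 2) (half_pos hε)
  obtain ⟨N, hN⟩ := Metric.tendsto_atTop.1 (mem_cZero.1 hy) (ε / 2) (half_pos hε)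
  refine ⟨N, fun n hn => ?_⟩
  have h1 := hN n hn
  have h2 : ‖x n - y n‖ ≤ ‖x - y‖ := lp.norm_apply_le_norm (by simp) (x - y) n
  rw [dist_eq_norm] at hxy
  simp only [dist_zero_right, norm_norm] at h1 ⊢
  have h3 : ‖x n‖ ≤ ‖x n - y n‖ + ‖y n‖ := by simpa using norm_add_le (x n - y n) (y n)
  linarith

theorem mul_mem_cZero_left (x : LInfty A) {y : LInfty A} (hy : y ∈ cZero A) :
    x * y ∈ cZero A := by
  rw [mem_cZero] at *
  refine squeeze_zero (fun n => norm_nonneg _) (fun n => ?_) (by simpa using hy.const_mul ‖x‖)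
  rw [lp.infty_coeFn_mul, Pi.mul_apply]
  exact (norm_mul_le _ _).trans
    (mul_le_mul_of_nonneg_right (lp.norm_apply_le_norm (by simp) x n) (norm_nonneg _))

theorem star_mem_cZero {x : LInfty A} (hx : x ∈ cZero A) : star x ∈ cZero A := by
  rw [mem_cZero] at *
  simpa [lp.star_apply] using hx

theorem mul_mem_cZero_right {x : LInfty A} (hx : x ∈ cZero A) (y : LInfty A) :
    x * y ∈ cZero A := by
  have := star_mem_cZero (mul_mem_cZero_left (star y) (star_mem_cZero hx))
  simpa using this

/-- The quotient `A_∞ = ℓ^∞(A) / c₀(A)`, with the quotient norm. -/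
abbrev SeqAlg (A : Type*) [NonUnitalCStarAlgebra A] : Type _ := LInfty A ⧸ cZero A

/-- The class in `A_∞` of a bounded sequence. -/
abbrev SeqAlg.mk (x : LInfty A) : SeqAlg A := (cZero A).mkQ x

namespace SeqAlg

instance : Mul (SeqAlg A) where
  mul := Quotient.map₂ (fun x y => x * y) <| by
    intro a b hab c d hcd
    change (cZero A).quotientRel a b at hab
    change (cZero A).quotientRel c d at hcd
    change (cZero A).quotientRel (a * c) (b * d)
    rw [Submodule.quotientRel_def] at *
    have : a * c - b * d = (a - b) * c + b * (c - d) := by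
      rw [sub_mul, mul_sub]; abel
    rw [this]
    exact (cZero A).add_mem (mul_mem_cZero_right hab c) (mul_mem_cZero_left b hcd)

instance : Star (SeqAlg A) where
  star := Quotient.map star <| by
    intro a b hab
    change (cZero A).quotientRel a b at hab
    change (cZero A).quotientRel (star a) (star b)
    rw [Submodule.quotientRel_def] at *
    rw [← star_sub]
    exact star_mem_cZero hab

theorem mk_mul (x y : LInfty A) : mk (x * y) = mk x * mk y := rfl

theorem mk_star (x : LInfty A) : mk (star x) = star (mk x) := rfl

theorem mk_surjective : Function.Surjective (mk : LInfty A → SeqAlg A) :=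
  (cZero A).mkQ_surjective

theorem norm_mk_le (x : LInfty A) : ‖mk x‖ ≤ ‖x‖ := Submodule.Quotient.norm_mk_le _ x

theorem exists_norm_lt (x : SeqAlg A) {ε : ℝ} (hε : 0 < ε) :
    ∃ a : LInfty A, mk a = x ∧ ‖a‖ < ‖x‖ + ε := Submodule.Quotient.norm_mk_lt x hε

instance : NonUnitalRing (SeqAlg A) where
  left_distrib x y z := by
    obtain ⟨x, rfl⟩ := mk_surjective x
    obtain ⟨y, rfl⟩ := mk_surjective y
    obtain ⟨z, rfl⟩ := mk_surjective z
    rw [← map_add, ← mk_mul, ← mk_mul, ← mk_mul, ← map_add, mul_add]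
  right_distrib x y z := by
    obtain ⟨x, rfl⟩ := mk_surjective x
    obtain ⟨y, rfl⟩ := mk_surjective y
    obtain ⟨z, rfl⟩ := mk_surjective z
    rw [← map_add, ← mk_mul, ← mk_mul, ← mk_mul, ← map_add, add_mul]
  zero_mul x := by
    obtain ⟨x, rfl⟩ := mk_surjective x
    rw [← map_zero (cZero A).mkQ, ← mk_mul, zero_mul]
  mul_zero x := by
    obtain ⟨x, rfl⟩ := mk_surjective x
    rw [← map_zero (cZero A).mkQ, ← mk_mul, mul_zero]
  mul_assoc x y z := by
    obtain ⟨x, rfl⟩ := mk_surjective x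
    obtain ⟨y, rfl⟩ := mk_surjective y
    obtain ⟨z, rfl⟩ := mk_surjective z
    rw [← mk_mul, ← mk_mul, ← mk_mul, ← mk_mul, mul_assoc]

theorem norm_mul_le' (x y : SeqAlg A) : ‖x * y‖ ≤ ‖x‖ * ‖y‖ := by
  have key : ∀ ε > 0, ‖x * y‖ ≤ (‖x‖ + ε) * (‖y‖ + ε) := by
    intro ε hε
    obtain ⟨a, rfl, ha⟩ := exists_norm_lt x hε
    obtain ⟨b, rfl, hb⟩ := exists_norm_lt y hε
    rw [← mk_mul]
    exact (norm_mk_le _).trans ((norm_mul_le a b).trans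
      (mul_le_mul ha.le hb.le (norm_nonneg _) ((norm_nonneg _).trans ha.le)))
  have hlim : Tendsto (fun ε : ℝ => (‖x‖ + ε) * (‖y‖ + ε)) (𝓝[>] 0) (𝓝 (‖x‖ * ‖y‖)) := by
    have : Continuous fun ε : ℝ => (‖x‖ + ε) * (‖y‖ + ε) := by fun_prop
    simpa using (this.tendsto 0).mono_left nhdsWithin_le_nhds
  exact ge_of_tendsto hlim (eventually_mem_nhdsWithin.mono fun ε hε => key ε hε)

instance : NonUnitalNormedRing (SeqAlg A) where
  __ := (inferInstance : NormedAddCommGroup (SeqAlg A))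
  __ := (inferInstance : NonUnitalRing (SeqAlg A))
  norm_mul_le := norm_mul_le'

instance : StarRing (SeqAlg A) where
  star_involutive x := by
    obtain ⟨x, rfl⟩ := mk_surjective x
    rw [← mk_star, ← mk_star, star_star]
  star_mul x y := by
    obtain ⟨x, rfl⟩ := mk_surjective x
    obtain ⟨y, rfl⟩ := mk_surjective y
    rw [← mk_star, ← mk_star, ← mk_mul, ← mk_mul, ← mk_star, star_mul]
  star_add x y := by
    obtain ⟨x, rfl⟩ := mk_surjective x
    obtain ⟨y, rfl⟩ := mk_surjective y
    rw [← mk_star, ← mk_star, ← map_add, ← map_add, ← mk_star, star_add]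

/-- The tail of a bounded sequence has the same class as the sequence. -/
theorem norm_mk_le_of_eventually (x : LInfty A) {C : ℝ} (hC : 0 ≤ C)
    (h : ∀ᶠ n in atTop, ‖x n‖ ≤ C) : ‖mk x‖ ≤ C := by
  obtain ⟨N, hN⟩ := eventually_atTop.1 h
  let f : ℕ → A := fun n => if N ≤ n then x n else 0
  have hfn : ∀ n, ‖f n‖ ≤ C := by
    intro n
    by_cases hn : N ≤ n
    · simpa [f, hn] using hN n hn
    · simpa [f, hn] using hC
  have hf : Memℓp f ∞ := memℓp_infty ⟨C, by rintro _ ⟨n, rfl⟩; exact hfn n⟩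
  let y : LInfty A := ⟨f, hf⟩
  have hxy : mk x = mk y := by
    refine (Submodule.Quotient.eq (cZero A)).2 (mem_cZero.2 ?_)
    refine (tendsto_const_nhds (x := (0 : ℝ))).congr' ?_
    filter_upwards [eventually_ge_atTop N] with n hn
    have : (x - y) n = 0 := by
      change x n - f n = 0
      simp [f, hn]
    rw [this, norm_zero]
  rw [hxy]
  exact (norm_mk_le y).trans (lp.norm_le_of_forall_le hC hfn)

instance : NonUnitalCStarAlgebra (SeqAlg A) where
  smul_assoc c x y := by
    obtain ⟨x, rfl⟩ := mk_surjective x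
    obtain ⟨y, rfl⟩ := mk_surjective y
    change mk (c • x) * mk y = c • (mk x * mk y)
    rw [← mk_mul, ← mk_mul, smul_mul_assoc]
    rfl
  smul_comm c x y := by
    obtain ⟨x, rfl⟩ := mk_surjective x
    obtain ⟨y, rfl⟩ := mk_surjective y
    change c • (mk x * mk y) = mk x * mk (c • y)
    rw [← mk_mul, ← mk_mul, mul_smul_comm]
    rfl
  star_smul c x := by
    obtain ⟨x, rfl⟩ := mk_surjective x
    change star (mk (c • x)) = star c • star (mk x)
    rw [← mk_star, ← mk_star, star_smul]
    rfl
  complete := (Submodule.Quotient.completeSpace (cZero A)).complete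
  norm_smul_le := norm_smul_le
  norm_mul_self_le x := by
    obtain ⟨x, rfl⟩ := mk_surjective x
    refine le_of_forall_pos_le_add fun ε hε => ?_
    obtain ⟨y, hy, hyn⟩ := exists_norm_lt (star (mk x) * mk x) (half_pos hε)
    set r := ‖star (mk x) * mk x‖ with hr
    have hr0 : 0 ≤ r := norm_nonneg _
    have hd : y - star x * x ∈ cZero A := by
      refine (Submodule.Quotient.eq (cZero A)).1 ?_
      exact hy
    have hev : ∀ᶠ n in atTop, ‖x n‖ ≤ Real.sqrt (r + ε) := by
      filter_upwards [(mem_cZero.1 hd).eventually (gt_mem_nhds (half_pos hε))] with n hn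
      apply Real.le_sqrt_of_sq_le
      have h1 : (y - star x * x) n = y n - star (x n) * x n := rfl
      have h2 : ‖y n‖ ≤ ‖y‖ := lp.norm_apply_le_norm (by simp) y n
      have h3 : ‖star (x n) * x n‖ ≤ ‖y n‖ + ‖y n - star (x n) * x n‖ := by
        simpa using norm_sub_le (y n) (y n - star (x n) * x n)
      rw [CStarRing.norm_star_mul_self, ← h1, ← sq] at h3
      linarith
    have := norm_mk_le_of_eventually x (Real.sqrt_nonneg _) hev
    calc ‖mk x‖ * ‖mk x‖ ≤ Real.sqrt (r + ε) * Real.sqrt (r + ε) :=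
          mul_self_le_mul_self (norm_nonneg _) this
      _ = r + ε := Real.mul_self_sqrt (by positivity)

/-- The canonical inclusion `A ⊆ A_∞`: an element goes to the class of the constant sequence. -/
def const (a : A) : SeqAlg A :=
  mk ⟨fun _ => a, memℓp_infty ⟨‖a‖, by rintro _ ⟨_, rfl⟩; exact le_rfl⟩⟩

/-- The map on `ℓ^∞` obtained by applying a bounded linear map entrywise. -/
def lInftyMap {B : Type*} [NonUnitalCStarAlgebra B] (T : A →L[ℂ] B) : LInfty A →L[ℂ] LInfty B :=
  LinearMap.mkContinuous
    { toFun := fun x => ⟨fun n => T (x n), memℓp_infty ⟨‖T‖ * ‖x‖, by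
        rintro _ ⟨n, rfl⟩
        exact (T.le_opNorm _).trans
          (mul_le_mul_of_nonneg_left (lp.norm_apply_le_norm (by simp) x n) (norm_nonneg _))⟩⟩
      map_add' := fun x y => lp.ext (funext fun n => T.map_add (x n) (y n))
      map_smul' := fun c x => lp.ext (funext fun n => T.map_smul c (x n)) }
    ‖T‖ fun x => lp.norm_le_of_forall_le (by positivity) fun n => (T.le_opNorm _).trans
      (mul_le_mul_of_nonneg_left (lp.norm_apply_le_norm (by simp) x n) (norm_nonneg _))

theorem lInftyMap_apply {B : Type*} [NonUnitalCStarAlgebra B] (T : A →L[ℂ] B) (x : LInfty A)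
    (n : ℕ) : lInftyMap T x n = T (x n) := rfl

/-- The map `T_∞ : A_∞ → B_∞` obtained by applying a bounded linear map `T` entrywise. -/
def map {B : Type*} [NonUnitalCStarAlgebra B] (T : A →L[ℂ] B) : SeqAlg A →L[ℂ] SeqAlg B where
  toLinearMap := (cZero A).mapQ (cZero B) (lInftyMap T).toLinearMap <| by
    intro x hx
    refine mem_cZero.2 ?_
    refine squeeze_zero (fun n => norm_nonneg _) (fun n => T.le_opNorm (x n)) ?_
    simpa using (mem_cZero.1 hx).const_mul ‖T‖
  cont := by
    refine AddMonoidHomClass.continuous_of_bound (f := (cZero A).mapQ (cZero B) _ _) ‖lInftyMap T‖ ?_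
    intro x
    refine le_of_forall_pos_le_add fun ε hε => ?_
    have hpos : 0 < ‖lInftyMap T‖ + 1 := by positivity
    obtain ⟨a, rfl, ha⟩ := exists_norm_lt x (div_pos hε hpos)
    have h1 : ‖mk (lInftyMap T a)‖ ≤ ‖lInftyMap T‖ * ‖a‖ :=
      (norm_mk_le _).trans ((lInftyMap T).le_opNorm a)
    have h2 : ‖lInftyMap T‖ * ‖a‖ ≤ ‖lInftyMap T‖ * (‖mk a‖ + ε / (‖lInftyMap T‖ + 1)) :=
      mul_le_mul_of_nonneg_left ha.le (norm_nonneg _)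
    have h3 : ‖lInftyMap T‖ * (ε / (‖lInftyMap T‖ + 1)) ≤ ε := by
      rw [← mul_div_assoc, div_le_iff₀ hpos]
      nlinarith [norm_nonneg (lInftyMap T)]
    have h4 : ‖mk (lInftyMap T a)‖ ≤ ‖lInftyMap T‖ * ‖mk a‖ + ε := by
      rw [mul_add] at h2; linarith
    exact h4

theorem map_mk {B : Type*} [NonUnitalCStarAlgebra B] (T : A →L[ℂ] B) (x : LInfty A) :
    map T (mk x) = mk (lInftyMap T x) := rfl

end SeqAlg

end SeqAlg

/-! ### The bidual `B**` of a C*-algebra -/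

section Bidual

/-- The Banach space bidual `B**` of a C*-algebra `B`. It carries the Arens product and the
canonical involution defined below, and is then the enveloping von Neumann algebra of `B`. -/
def Bidual (B : Type*) [NonUnitalCStarAlgebra B] : Type _ := StrongDual ℂ (StrongDual ℂ B)

variable {B : Type*} [NonUnitalCStarAlgebra B]

instance : NormedAddCommGroup (Bidual B) :=
  inferInstanceAs (NormedAddCommGroup (StrongDual ℂ (StrongDual ℂ B)))

instance : NormedSpace ℂ (Bidual B) :=
  inferInstanceAs (NormedSpace ℂ (StrongDual ℂ (StrongDual ℂ B)))

instance : FunLike (Bidual B) (StrongDual ℂ B) ℂ :=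
  inferInstanceAs (FunLike (StrongDual ℂ (StrongDual ℂ B)) (StrongDual ℂ B) ℂ)

/-- The canonical embedding `B ⊆ B**`, which sends `b` to the evaluation `φ ↦ φ b`. -/
def toBidual (b : B) : Bidual B := NormedSpace.inclusionInDoubleDual ℂ B b

/-- For `φ ∈ B*`, the map `a ↦ φ · a`, where `(φ · a) b = φ (a * b)`. -/
def dualMulRight (φ : StrongDual ℂ B) : B →L[ℂ] StrongDual ℂ B :=
  (ContinuousLinearMap.compL ℂ B B ℂ φ).comp (ContinuousLinearMap.mul ℂ B)

theorem dualMulRight_apply (φ : StrongDual ℂ B) (a b : B) : dualMulRight φ a b = φ (a * b) := rfl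

/-- For `y ∈ B**`, the map `φ ↦ y · φ` on `B*`, where `(y · φ) a = y (φ · a)`. -/
def bidualMulDual (y : StrongDual ℂ (StrongDual ℂ B)) : StrongDual ℂ B →L[ℂ] StrongDual ℂ B :=
  LinearMap.mkContinuous
    { toFun := fun φ => y.comp (dualMulRight φ)
      map_add' := fun φ ψ => by
        ext a
        have : dualMulRight (φ + ψ) a = dualMulRight φ a + dualMulRight ψ a := rfl
        simp [this]
      map_smul' := fun c φ => by
        ext a
        have : dualMulRight (c • φ) a = c • dualMulRight φ a := rfl
        simp [this] }
    ‖y‖ fun φ => by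
      refine ContinuousLinearMap.opNorm_le_bound _ (by positivity) fun a => ?_
      have h1 : ‖dualMulRight φ a‖ ≤ ‖φ‖ * ‖a‖ :=
        ContinuousLinearMap.opNorm_le_bound _ (by positivity) fun b => by
          rw [dualMulRight_apply, mul_assoc]
          exact (φ.le_opNorm _).trans
            (mul_le_mul_of_nonneg_left (norm_mul_le a b) (norm_nonneg _))
      calc ‖y (dualMulRight φ a)‖ ≤ ‖y‖ * ‖dualMulRight φ a‖ := y.le_opNorm _
        _ ≤ ‖y‖ * (‖φ‖ * ‖a‖) := by gcongr
        _ = ‖y‖ * ‖φ‖ * ‖a‖ := by ring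

/-- The (first) Arens product on the bidual: `(x * y) φ = x (y · φ)`. Since C*-algebras are Arens
regular, it is the unique separately weak*-continuous extension of the product of `B`. -/
instance : Mul (Bidual B) where
  mul x y := ContinuousLinearMap.comp (show StrongDual ℂ (StrongDual ℂ B) from x) (bidualMulDual y)

/-- The involution on the dual: `φ* a = conj (φ (a*))`. -/
def dualStar (φ : StrongDual ℂ B) : StrongDual ℂ B :=
  ((starL ℂ : ℂ ≃L⋆[ℂ] ℂ) : ℂ →L⋆[ℂ] ℂ).comp
    (φ.comp ((starL ℂ : B ≃L⋆[ℂ] B) : B →L⋆[ℂ] B))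

theorem dualStar_apply (φ : StrongDual ℂ B) (a : B) : dualStar φ a = star (φ (star a)) := rfl

theorem norm_dualStar_le (φ : StrongDual ℂ B) : ‖dualStar φ‖ ≤ ‖φ‖ :=
  ContinuousLinearMap.opNorm_le_bound _ (norm_nonneg _) fun a => by
    rw [dualStar_apply, norm_star]
    simpa using φ.le_opNorm (star a)

/-- The involution on the bidual: `x* φ = conj (x (φ*))`. It extends the involution of `B`. -/
instance : Star (Bidual B) where
  star x := LinearMap.mkContinuous
    { toFun := fun φ => star (x (dualStar φ))
      map_add' := fun φ ψ => by
        have : dualStar (φ + ψ) = dualStar φ + dualStar ψ := by ext; simp [dualStar_apply]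
        have h2 : x (dualStar φ + dualStar ψ) = x (dualStar φ) + x (dualStar ψ) :=
          ContinuousLinearMap.map_add (show StrongDual ℂ (StrongDual ℂ B) from x) _ _
        rw [this, h2, star_add]
      map_smul' := fun c φ => by
        have : dualStar (c • φ) = star c • dualStar φ := by ext; simp [dualStar_apply]
        have h2 : x (star c • dualStar φ) = star c • x (dualStar φ) :=
          ContinuousLinearMap.map_smul (show StrongDual ℂ (StrongDual ℂ B) from x) _ _
        rw [this, h2]
        simp }
    ‖x‖ fun φ => by
      change ‖star (x (dualStar φ))‖ ≤ ‖x‖ * ‖φ‖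
      rw [norm_star]
      exact (ContinuousLinearMap.le_opNorm (show StrongDual ℂ (StrongDual ℂ B) from x) _).trans
        (mul_le_mul_of_nonneg_left (norm_dualStar_le φ) (norm_nonneg _))

theorem Bidual.mul_apply (x y : Bidual B) (φ : StrongDual ℂ B) :
    (x * y) φ = x (bidualMulDual y φ) := rfl

theorem bidualMulDual_apply (y : Bidual B) (φ : StrongDual ℂ B) (a : B) :
    bidualMulDual y φ a = y (dualMulRight φ a) := rfl

theorem Bidual.star_apply (x : Bidual B) (φ : StrongDual ℂ B) :
    (star x) φ = star (x (dualStar φ)) := rfl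

theorem toBidual_apply (b : B) (φ : StrongDual ℂ B) : toBidual b φ = φ b := rfl

theorem toBidual_mul (a b : B) : toBidual (a * b) = toBidual a * toBidual b := rfl

theorem toBidual_star (a : B) : toBidual (star a) = star (toBidual a) :=
  DFunLike.ext _ _ fun φ => by
    simp [toBidual_apply, Bidual.star_apply, dualStar_apply]

/-- The bidual map `T** : B** → C**` of a bounded linear map: `(T** x) φ = x (φ ∘ T)`. -/
def bidualMap {C : Type*} [NonUnitalCStarAlgebra C] (T : B →L[ℂ] C) (x : Bidual B) : Bidual C :=
  ContinuousLinearMap.comp (show StrongDual ℂ (StrongDual ℂ B) from x)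
    ((ContinuousLinearMap.compL ℂ B C ℂ).flip T)

theorem bidualMap_apply {C : Type*} [NonUnitalCStarAlgebra C] (T : B →L[ℂ] C) (x : Bidual B)
    (φ : StrongDual ℂ C) : bidualMap T x φ = x (φ.comp T) := rfl

end Bidual

/-! ### Group actions and the Rokhlin* property -/

section Rokhlin

variable {A : Type*} [NonUnitalCStarAlgebra A]

/-- A *-automorphism of a C*-algebra, as a bounded linear map. -/
def autCLM (σ : A ≃⋆ₐ[ℂ] A) : A →L[ℂ] A :=
  LinearMap.mkContinuous
    { toFun := σ, map_add' := map_add σ, map_smul' := fun c a => map_smul σ c a } 1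
    fun a => by simpa using! NonUnitalStarAlgHom.norm_apply_le σ a

variable {G : Type*} [Group G]

/-- The induced action on `(A_∞)**` of an action `α` of a discrete group on `A`. With
`(t.φ) b = φ (t⁻¹.b)` on the dual, `(t.x) φ = x (t⁻¹.φ)` is the bidual map of `b ↦ t.b`, which acts
on `A_∞` entrywise. -/
def bidualAct (α : G →* (A ≃⋆ₐ[ℂ] A)) (t : G) (x : Bidual (SeqAlg A)) : Bidual (SeqAlg A) :=
  bidualMap (SeqAlg.map (autCLM (α t))) x

/-- The canonical inclusion `A ⊆ A_∞ ⊆ (A_∞)**`. -/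
def incl (a : A) : Bidual (SeqAlg A) := toBidual (SeqAlg.const a)

/-- The action `α` of the discrete group `G` on `A` has the Rokhlin* property: there is a projection
`p` in `A' ∩ (A_∞)**` such that `p ⊥ t.p` for all `t ≠ e`, and for every nonzero `a` in `A` there
is `t` in `G` with `a (t.p) ≠ 0`. -/
def HasRokhlinStar (α : G →* (A ≃⋆ₐ[ℂ] A)) : Prop :=
  ∃ p : Bidual (SeqAlg A), IsStarProjection p ∧
    (∀ a : A, incl a * p = p * incl a) ∧
    (∀ t : G, t ≠ 1 → p * bidualAct α t p = 0) ∧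
    ∀ a : A, a ≠ 0 → ∃ t : G, incl a * bidualAct α t p ≠ 0

end Rokhlin

/-! ### Ideals and proper outerness -/

section Outer

/-- An ideal of a C*-algebra: a closed two-sided ideal. -/
structure ClosedIdeal (A : Type*) [NonUnitalCStarAlgebra A] extends Submodule ℂ A where
  mul_mem_left' : ∀ (a : A) {x : A}, x ∈ carrier → a * x ∈ carrier
  mul_mem_right' : ∀ {x : A} (a : A), x ∈ carrier → x * a ∈ carrier
  isClosed' : IsClosed carrier

variable {A : Type*} [NonUnitalCStarAlgebra A]

namespace ClosedIdeal

instance : SetLike (ClosedIdeal A) A where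
  coe I := I.carrier
  coe_injective := by
    rintro ⟨I, _, _, _⟩ ⟨J, _, _, _⟩ h
    have : I = J := SetLike.coe_injective h
    subst this
    rfl

instance : NonUnitalSubringClass (ClosedIdeal A) A where
  add_mem {I} _ _ hx hy := I.add_mem' hx hy
  zero_mem I := I.zero_mem'
  neg_mem {I} _ hx := I.toSubmodule.neg_mem hx
  mul_mem {I} a _ _ hb := I.mul_mem_left' a hb

instance : SMulMemClass (ClosedIdeal A) ℂ A where
  smul_mem {I} c _ hx := I.smul_mem' c hx

theorem mul_mem_left (I : ClosedIdeal A) (a : A) {x : A} (hx : x ∈ I) : a * x ∈ I :=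
  I.mul_mem_left' a hx

theorem mul_mem_right (I : ClosedIdeal A) {x : A} (a : A) (hx : x ∈ I) : x * a ∈ I :=
  I.mul_mem_right' a hx

instance isClosed_coe (I : ClosedIdeal A) : IsClosed (I : Set A) := I.isClosed'

/-- The self-adjoint part `{x ∈ I | x* ∈ I}` of an ideal; it is in fact all of `I`. -/
def selfAdjointPart (I : ClosedIdeal A) : NonUnitalStarSubalgebra ℂ A where
  carrier := {x | x ∈ I ∧ star x ∈ I}
  add_mem' hx hy := ⟨add_mem hx.1 hy.1, by rw [star_add]; exact add_mem hx.2 hy.2⟩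
  zero_mem' := ⟨zero_mem I, by rw [star_zero]; exact zero_mem I⟩
  mul_mem' {x y} hx hy := ⟨mul_mem hx.1 hy.1, by rw [star_mul]; exact mul_mem hy.2 hx.2⟩
  smul_mem' c x hx := ⟨SMulMemClass.smul_mem c hx.1, by
    rw [star_smul]; exact SMulMemClass.smul_mem _ hx.2⟩
  star_mem' {x} hx := ⟨hx.2, by rw [star_star]; exact hx.1⟩

instance (I : ClosedIdeal A) : IsClosed (I.selfAdjointPart : Set A) :=
  I.isClosed_coe.inter (I.isClosed_coe.preimage continuous_star)

/-- A closed two-sided ideal of a C*-algebra is self-adjoint. -/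
theorem star_mem (I : ClosedIdeal A) {a : A} (ha : a ∈ I) : star a ∈ I := by
  let J := I.selfAdjointPart
  let _ : PartialOrder J := CStarAlgebra.spectralOrder J
  have : StarOrderedRing J := CStarAlgebra.spectralOrderedRing J
  let h : J := ⟨a * star a, I.mul_mem_right _ ha, by
    rw [star_mul, star_star]; exact I.mul_mem_right _ ha⟩
  have hau := CStarAlgebra.increasingApproximateUnit J
  have h1 : Tendsto (fun e : J => h * e) (CStarAlgebra.approximateUnit J) (𝓝 h) :=
    hau.tendsto_mul_left h
  have h2 : Tendsto (fun e : J => ‖h - h * e‖) (CStarAlgebra.approximateUnit J) (𝓝 0) := by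
    have h0 := ((tendsto_const_nhds (x := h)).sub h1).norm
    rwa [sub_self, norm_zero] at h0
  have h3 : Tendsto (fun e : J => ‖h - h * e‖ * 2) (CStarAlgebra.approximateUnit J) (𝓝 0) := by
    simpa using h2.mul_const 2
  have h4 : Tendsto (fun e : J => ‖star a - star a * (e : A)‖ ^ 2)
      (CStarAlgebra.approximateUnit J) (𝓝 0) := by
    refine squeeze_zero' (Eventually.of_forall fun e => by positivity) ?_ h3
    filter_upwards [hau.eventually_isSelfAdjoint, hau.eventually_norm] with e he hen
    have hes : star (e : A) = e := congrArg Subtype.val he.star_eq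
    have hen' : ‖(e : A)‖ ≤ 1 := hen
    have hk : star (star a - star a * (e : A)) * (star a - star a * (e : A))
        = (a * star a - a * star a * e) - e * (a * star a - a * star a * e) := by
      simp only [star_sub, star_mul, star_star, hes, sub_mul, mul_sub, mul_assoc]
      abel
    rw [sq, ← CStarRing.norm_star_mul_self, hk]
    have hb : ‖h - h * e‖ = ‖a * star a - a * star a * (e : A)‖ := rfl
    rw [hb, mul_two]
    refine (norm_sub_le _ _).trans (add_le_add_right ((norm_mul_le _ _).trans ?_) _)
    exact mul_le_of_le_one_left (norm_nonneg _) hen'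
  have h5 : Tendsto (fun e : J => star a * (e : A)) (CStarAlgebra.approximateUnit J)
      (𝓝 (star a)) := by
    have h6 := h4.sqrt
    simp only [Real.sqrt_sq (norm_nonneg _), Real.sqrt_zero] at h6
    have h7 := tendsto_zero_iff_norm_tendsto_zero.2 h6
    have h8 := (tendsto_const_nhds (x := star a)).sub h7
    simpa using h8
  exact I.isClosed_coe.mem_of_tendsto h5 (Eventually.of_forall fun e => I.mul_mem_left _ e.2.1)

instance : StarMemClass (ClosedIdeal A) A where
  star_mem {I} _ hx := I.star_mem hx

instance (I : ClosedIdeal A) : NonUnitalCStarAlgebra I :=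
  NonUnitalStarSubalgebra.nonUnitalCStarAlgebra I (h_closed := I.isClosed_coe)

end ClosedIdeal

/-- The ideal `I` is invariant under the group `⟨σ⟩` generated by the automorphism `σ`. -/
def IsInvariant (σ : A ≃⋆ₐ[ℂ] A) (I : ClosedIdeal A) : Prop :=
  ∀ τ ∈ Subgroup.zpowers σ, ∀ x ∈ I, τ x ∈ I

/-- The restriction of the automorphism `σ` to a `⟨σ⟩`-invariant ideal. -/
def restrictIdeal (σ : A ≃⋆ₐ[ℂ] A) (I : ClosedIdeal A) (hI : IsInvariant σ I) : I →L[ℂ] I :=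
  LinearMap.mkContinuous
    { toFun := fun x => ⟨σ x, hI σ (Subgroup.mem_zpowers σ) x x.2⟩
      map_add' := fun x y => Subtype.ext (map_add σ (x : A) (y : A))
      map_smul' := fun c x => Subtype.ext (map_smul σ c (x : A)) } 1
    fun x => by simpa using! NonUnitalStarAlgHom.norm_apply_le σ (x : A)

/-- The inner automorphism `Ad(u) : x ↦ u x u*` of a C*-algebra `B` given by a unitary `u` of its
multiplier algebra. A multiplier `m` is the pair `(m.fst, m.snd)` of left and right multiplication by
`m` on `B`. -/
def innerAut {B : Type*} [NonUnitalCStarAlgebra B] (u : unitary 𝓜(ℂ, B)) : B →L[ℂ] B :=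
  (star (u : 𝓜(ℂ, B))).snd.comp (u : 𝓜(ℂ, B)).fst

theorem coe_innerAut {B : Type*} [NonUnitalCStarAlgebra B] (u : unitary 𝓜(ℂ, B)) (x : B) :
    ((innerAut u x : B) : 𝓜(ℂ, B)) = (u : 𝓜(ℂ, B)) * (x : 𝓜(ℂ, B)) * star (u : 𝓜(ℂ, B)) := by
  have cancel_left : ∀ z w : B, (∀ y, y * z = y * w) → z = w := fun z w h => by
    rw [← sub_eq_zero, ← CStarRing.star_mul_self_eq_zero_iff, mul_sub, h, sub_self]
  have cancel_right : ∀ z w : B, (∀ y, z * y = w * y) → z = w := fun z w h => by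
    rw [← sub_eq_zero, ← CStarRing.mul_star_self_eq_zero_iff, sub_mul, h, sub_self]
  have hfst : ∀ (m : 𝓜(ℂ, B)) (y z : B), m.fst (y * z) = m.fst y * z := fun m y z =>
    cancel_left _ _ fun w => by rw [← m.central, ← mul_assoc, m.central, mul_assoc]
  have hsnd : ∀ (m : 𝓜(ℂ, B)) (y z : B), m.snd (y * z) = y * m.snd z := fun m y z =>
    cancel_right _ _ fun w => by rw [m.central, mul_assoc, ← m.central, mul_assoc]
  refine DoubleCentralizer.ext ℂ B _ _ (Prod.ext ?_ ?_)
  · refine ContinuousLinearMap.ext fun b => ?_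
    change (star (u : 𝓜(ℂ, B))).snd ((u : 𝓜(ℂ, B)).fst x) * b
      = (u : 𝓜(ℂ, B)).fst (x * (star (u : 𝓜(ℂ, B))).fst b)
    rw [(star (u : 𝓜(ℂ, B))).central, hfst]
  · refine ContinuousLinearMap.ext fun b => ?_
    change b * (star (u : 𝓜(ℂ, B))).snd ((u : 𝓜(ℂ, B)).fst x)
      = (star (u : 𝓜(ℂ, B))).snd ((u : 𝓜(ℂ, B)).snd b * x)
    rw [← hsnd, (u : 𝓜(ℂ, B)).central]

/-- An automorphism `σ` of `A` is properly outer: for every nonzero `⟨σ⟩`-invariant ideal `I` of `A`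
and every inner automorphism `Ad(u)` of `I`, the norm of `σ|_I - Ad(u)` is `2`. -/
def IsProperlyOuterAut (σ : A ≃⋆ₐ[ℂ] A) : Prop :=
  ∀ (I : ClosedIdeal A) (hI : IsInvariant σ I), (∃ x ∈ I, x ≠ 0) →
    ∀ u : unitary 𝓜(ℂ, I), ‖restrictIdeal σ I hI - innerAut u‖ = 2

/-- An action is properly outer if `α t` is properly outer for every `t ≠ e`. -/
def IsProperlyOuter {G : Type*} [Group G] (α : G →* (A ≃⋆ₐ[ℂ] A)) : Prop :=
  ∀ t : G, t ≠ 1 → IsProperlyOuterAut (α t)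

end Outer

end RokhlinStar

end

/-!
# Rokhlin* actions are properly outer

The upper bound `2` is the triangle inequality. For the lower bound, work in the bidual `M` of
`A_∞`. Every translate of the Rokhlin projection commutes with `A`, and one of them, `q`, satisfies
`h q ≠ 0` for some self-adjoint `h` in the given ideal `I`. Let `σ = α_t`, let `q₁ = σ(q)` and
`q₂ = σ²(q)`; then `q₁` is orthogonal to `q` and to `q₂`. Formally, the test element is
`x = h q h - q₁ (u* σ(h)² u)`. Its two terms are orthogonal and both have norm `m = ‖h q h‖`, so
`‖x‖ = m`. On the other hand the parts of `σ(x)` and `u x u*` under `q₁` are `q₁ σ(h)²` and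
`-q₁ σ(h)²`, so `‖σ(x) - u x u*‖ ≥ 2 m`, and since `m ≠ 0` this gives `‖σ|_I - Ad(u)‖ ≥ 2`
(`two_le_norm_sub_innerAut`).

The unitary `u` multiplies only `I`, not `A_∞` or `M`. The second term of `x` is therefore written
as `f q₁ e` with `f = u* σ(h)` and `e = σ(h) u` in `I`. Elements `c y d` with `c`, `d` in `I` come
from the bidual of `I_∞`, which embeds isometrically in `M`, and there `σ|_I - Ad(u)` has a bidual
extension of no larger norm (`norm_bidual_sub_innerAut_le`).

The norm computations need `M`, with the Arens product, to be a C*-algebra. A representation `π` of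
a C*-algebra `B` extends to its bidual by `⟪ζ, π(x) η⟫ = x ⟪ζ, π(·) η⟫`, and the extension is a
contractive *-homomorphism (`bidualRep_mul`, `bidualRep_star`, `norm_bidualRep_le`). It remains to
see that enough representations exist, with control of the norms: every `φ` in `B*` has the form
`⟪ζ, π(·) η⟫` with `‖ζ‖ ≤ 1` and `‖η‖ ≤ ‖φ‖` (`exists_vectorFunctional_eq`). This follows from
the GNS construction for a positive functional `ψ` with `|φ a|² ≤ ψ (a* a)` and `ψ 1 = ‖φ‖²`,
which a Hahn–Banach argument provides (`exists_positive_dominating`).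
-/

namespace RokhlinStar

universe u

/-! ### Functionals on a C*-algebra as vector functionals -/

open scoped ComplexOrder InnerProductSpace ComplexStarModule

section Dominating

variable {B : Type*} [CStarAlgebra B] [PartialOrder B] [StarOrderedRing B]

/-- A one-dimensional form of the noncommutative Grothendieck inequality. With
`c i = conj (φ (a i))` the sum on the left is `φ (∑ c i • a i)`, and `‖∑ c i • a i‖` is estimated
by the Cauchy–Schwarz inequality in the Hilbert module `B ^ ι`. -/
theorem sum_norm_sq_le {ι : Type*} [Fintype ι] (φ : StrongDual ℂ B) (a : ι → B) :
    ∑ i, ‖φ (a i)‖ ^ 2 ≤ ‖φ‖ ^ 2 * ‖∑ i, star (a i) * a i‖ := by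
  set s : ℝ := ∑ i, ‖φ (a i)‖ ^ 2 with hs
  have hs0 : 0 ≤ s := Finset.sum_nonneg fun i _ => by positivity
  set b : B := ∑ i, star (φ (a i)) • a i with hb
  have hφb : φ b = (s : ℂ) := by
    simp [hb, hs, map_sum, Complex.conj_mul']
  let x : WithCStarModule B (ι → B) := (WithCStarModule.equiv B (ι → B)).symm
    fun i => star (φ (a i)) • 1
  let y : WithCStarModule B (ι → B) := (WithCStarModule.equiv B (ι → B)).symm
    fun i => star (a i)
  have hxy : inner B x y = star b := by
    simp [WithCStarModule.pi_inner, x, y, hb, WithCStarModule.inner_def]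
  have hy : ‖y‖ ^ 2 = ‖∑ i, star (a i) * a i‖ := by
    rw [WithCStarModule.pi_norm_sq]
    simp [y, WithCStarModule.inner_def]
  have hx : ‖x‖ ^ 2 ≤ s := by
    rw [WithCStarModule.pi_norm_sq]
    refine (norm_sum_le _ _).trans (Finset.sum_le_sum fun i _ => ?_)
    have h1 : ‖(1 : B)‖ ≤ 1 := by
      rcases subsingleton_or_nontrivial B with h | h
      · rw [Subsingleton.elim (1 : B) 0, norm_zero]; exact zero_le_one
      · exact CStarRing.norm_one.le
    simp only [x, WithCStarModule.inner_def, WithCStarModule.equiv_symm_pi_apply, star_smul,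
      star_one, smul_mul_smul, mul_one, norm_smul]
    refine (mul_le_mul_of_nonneg_left h1 (norm_nonneg _)).trans ?_
    rw [mul_one, norm_mul, norm_star, norm_star, norm_star, sq]
  have hbn : ‖b‖ ≤ ‖x‖ * ‖y‖ := by
    rw [← norm_star, ← hxy]; exact CStarModule.norm_inner_le (A := B) _
  have hx0 : 0 ≤ ‖x‖ := CStarModule.norm_nonneg (A := B)
  have hy0 : 0 ≤ ‖y‖ := CStarModule.norm_nonneg (A := B)
  have h1 : s ≤ ‖φ‖ * (‖x‖ * ‖y‖) := by
    calc s = ‖φ b‖ := by rw [hφb, Complex.norm_real, Real.norm_of_nonneg hs0]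
      _ ≤ ‖φ‖ * ‖b‖ := φ.le_opNorm b
      _ ≤ _ := by gcongr
  rw [← hy]
  rcases hs0.eq_or_lt with h0 | h0
  · rw [← h0]; positivity
  · refine le_of_mul_le_mul_left ?_ h0
    calc s * s ≤ (‖φ‖ * (‖x‖ * ‖y‖)) * (‖φ‖ * (‖x‖ * ‖y‖)) :=
          mul_self_le_mul_self hs0 h1
      _ = ‖x‖ ^ 2 * (‖φ‖ ^ 2 * ‖y‖ ^ 2) := by ring
      _ ≤ s * (‖φ‖ ^ 2 * ‖y‖ ^ 2) := by gcongr

/-- The cone of the pairs `(h, r)` for which `ψ h ≥ r` is forced by positivity of `ψ` and by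
`|φ a|² ≤ ψ (a* a)`. Elements of `B` that are not self-adjoint enter through their real part. -/
def dominationCone (φ : StrongDual ℂ B) : PointedCone ℝ (B × ℝ) where
  carrier := {z | ∃ (ι : Type) (_ : Fintype ι) (a : ι → B),
    ∑ i, star (a i) * a i ≤ ((ℜ z.1 : selfAdjoint B) : B) ∧ z.2 ≤ ∑ i, ‖φ (a i)‖ ^ 2}
  zero_mem' := ⟨Empty, inferInstance, Empty.elim, by simp, by simp⟩
  add_mem' := by
    rintro z w ⟨ι, _, a, ha, ha'⟩ ⟨κ, _, b, hb, hb'⟩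
    refine ⟨ι ⊕ κ, inferInstance, Sum.elim a b, ?_, ?_⟩
    · simpa [Fintype.sum_sum_type] using add_le_add ha hb
    · simpa [Fintype.sum_sum_type] using add_le_add ha' hb'
  smul_mem' := by
    rintro ⟨c, hc⟩ z ⟨ι, _, a, ha, ha'⟩
    have hcc : √c * √c = c := Real.mul_self_sqrt hc
    refine ⟨ι, inferInstance, fun i => √c • a i, ?_, ?_⟩
    · have h : ∑ i, star (√c • a i) * √c • a i = c • ∑ i, star (a i) * a i := by
        simp [star_smul, smul_smul, hcc, Finset.smul_sum]
      have h' : ((ℜ (((⟨c, hc⟩ : {x : ℝ // 0 ≤ x}) • z).1) : selfAdjoint B) : B)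
          = c • ((ℜ z.1 : selfAdjoint B) : B) := by
        rw [← selfAdjoint.val_smul, ← map_smul]; rfl
      rw [h, h']
      exact smul_le_smul_of_nonneg_left ha hc
    · have h : ∀ i, ‖φ (√c • a i)‖ ^ 2 = c * ‖φ (a i)‖ ^ 2 := fun i => by
        have : φ (√c • a i) = (√c : ℂ) • φ (a i) := by
          rw [← map_smul]; congr 1
        rw [this, norm_smul, mul_pow, Complex.norm_real, Real.norm_of_nonneg (Real.sqrt_nonneg _),
          sq √c, hcc]
      simp only [h, ← Finset.mul_sum]
      exact mul_le_mul_of_nonneg_left ha' hc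

theorem mem_dominationCone {φ : StrongDual ℂ B} {z : B × ℝ} :
    z ∈ dominationCone φ ↔ ∃ (ι : Type) (_ : Fintype ι) (a : ι → B),
      ∑ i, star (a i) * a i ≤ ((ℜ z.1 : selfAdjoint B) : B) ∧ z.2 ≤ ∑ i, ‖φ (a i)‖ ^ 2 := Iff.rfl

/-- Every bounded functional `φ` is dominated by a positive one: `|φ a|² ≤ ψ (a* a)` with
`ψ 1 = ‖φ‖²`. The functional `ψ` is found with M. Riesz's extension theorem; that the prescribed
values on the multiples of `1` are consistent is `sum_norm_sq_le`. -/
theorem exists_positive_dominating [Nontrivial B] (φ : StrongDual ℂ B) :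
    ∃ ψ : B →ₚ[ℂ] ℂ, ψ 1 = ((‖φ‖ ^ 2 : ℝ) : ℂ) ∧ ∀ a, ((‖φ a‖ ^ 2 : ℝ) : ℂ) ≤ ψ (star a * a) := by
  let j : ℝ × ℝ →ₗ[ℝ] B × ℝ := (LinearMap.toSpanSingleton ℝ B 1).prodMap LinearMap.id
  have hj : ∀ w, j w = (w.1 • 1, w.2) := fun w => rfl
  have hinj : Function.Injective j := by
    rintro ⟨a, b⟩ ⟨c, d⟩ h
    rw [hj, hj, Prod.mk.injEq] at h
    exact Prod.ext (smul_left_injective ℝ (one_ne_zero (α := B)) h.1) h.2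
  let f₀ : ℝ × ℝ →ₗ[ℝ] ℝ := ‖φ‖ ^ 2 • LinearMap.fst ℝ ℝ ℝ - LinearMap.snd ℝ ℝ ℝ
  let f : (B × ℝ) →ₗ.[ℝ] ℝ :=
    ⟨LinearMap.range j, f₀ ∘ₗ (LinearEquiv.ofInjective j hinj).symm.toLinearMap⟩
  have hf : ∀ w h, f ⟨j w, h⟩ = ‖φ‖ ^ 2 * w.1 - w.2 := by
    intro w h
    have : (⟨j w, h⟩ : LinearMap.range j) = LinearEquiv.ofInjective j hinj w := rfl
    change f₀ ((LinearEquiv.ofInjective j hinj).symm ⟨j w, h⟩) = _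
    rw [this, LinearEquiv.symm_apply_apply]
    simp [f₀]
  have hre1 : ∀ c : ℝ, ((ℜ (c • (1 : B)) : selfAdjoint B) : B) = c • 1 := fun c => by
    rw [map_smul, selfAdjoint.val_smul, IsSelfAdjoint.coe_realPart (IsSelfAdjoint.one B)]
  obtain ⟨g, hgf, hg⟩ := riesz_extension (dominationCone φ) f (by
    rintro ⟨_, w, rfl⟩ hw
    obtain ⟨ι, _, a, ha, ha'⟩ := mem_dominationCone.1 hw
    refine le_of_le_of_eq ?_ (hf w ⟨w, rfl⟩).symm
    simp only [hj] at ha ha'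
    rw [hre1] at ha
    have h0 : 0 ≤ ∑ i, star (a i) * a i := Finset.sum_nonneg fun i _ => star_mul_self_nonneg _
    have hw1 : 0 ≤ w.1 := by
      by_contra! hneg
      have h : w.1 • (1 : B) = 0 :=
        le_antisymm (smul_nonpos_of_nonpos_of_nonneg hneg.le zero_le_one) (h0.trans ha)
      exact hneg.ne ((smul_eq_zero_iff_left one_ne_zero).1 h)
    have h1 : ‖∑ i, star (a i) * a i‖ ≤ w.1 := by
      rw [CStarAlgebra.norm_le_iff_le_algebraMap _ hw1 h0, Algebra.algebraMap_eq_smul_one]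
      exact ha
    have h2 := sum_norm_sq_le φ a
    have h3 := mul_le_mul_of_nonneg_left h1 (sq_nonneg ‖φ‖)
    linarith) (by
    rintro ⟨h, r⟩
    refine ⟨⟨_, (‖((ℜ h : selfAdjoint B) : B)‖, -r), rfl⟩, ?_⟩
    refine mem_dominationCone.2 ⟨Empty, inferInstance, Empty.elim, ?_, ?_⟩
    · simp only [hj, Prod.mk_add_mk, Finset.univ_eq_empty, Finset.sum_empty, map_add,
        AddSubgroup.coe_add]
      rw [hre1, ← Algebra.algebraMap_eq_smul_one, ← neg_le_iff_add_nonneg']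
      exact IsSelfAdjoint.neg_algebraMap_norm_le_self (ℜ h).2
    · simp [hj])
  have hgj : ∀ w, g (j w) = ‖φ‖ ^ 2 * w.1 - w.2 := fun w => by rw [← hf w ⟨w, rfl⟩, ← hgf]
  let g₁ : Module.Dual ℝ B := g ∘ₗ LinearMap.inl ℝ B ℝ
  have hI : ∀ h : B, IsSelfAdjoint h → g₁ (Complex.I • h) = 0 := by
    intro h hh
    have key : ∀ c : ℝ, ((c • Complex.I • h, 0) : B × ℝ) ∈ dominationCone φ := fun c =>
      mem_dominationCone.2 ⟨Empty, inferInstance, Empty.elim, by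
        simp [map_smul, realPart_I_smul, hh.imaginaryPart], by simp⟩
    have h1 := hg _ (key 1)
    have h2 := hg _ (key (-1))
    rw [one_smul] at h1
    have h3 : ((-1 : ℝ) • Complex.I • h, (0 : ℝ)) = -((Complex.I • h, 0) : B × ℝ) := by simp
    rw [h3, map_neg] at h2
    exact le_antisymm (neg_nonneg.1 h2) h1
  let ψ₀ : B →ₗ[ℂ] ℂ := Module.Dual.extendRCLike g₁
  have hψ₀ : ∀ h : B, IsSelfAdjoint h → ψ₀ h = (g₁ h : ℂ) := by
    intro h hh
    have : ψ₀ h = (g₁ h : ℂ) - Complex.I * (g₁ (Complex.I • h) : ℂ) :=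
      Module.Dual.extendRCLike_apply g₁ h
    rw [this, hI h hh]; simp
  refine ⟨PositiveLinearMap.mk₀ ψ₀ fun h hh => ?_, ?_, fun a => ?_⟩
  · rw [hψ₀ h hh.isSelfAdjoint]
    refine Complex.zero_le_real.2 (hg _ (mem_dominationCone.2
      ⟨Empty, inferInstance, Empty.elim, ?_, by simp⟩))
    simpa [hh.isSelfAdjoint.coe_realPart] using hh
  · change ψ₀ 1 = _
    rw [hψ₀ 1 (IsSelfAdjoint.one B)]
    have := hgj (1, 0)
    simp only [hj, one_smul, mul_one, sub_zero] at this
    exact congrArg _ this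
  · change _ ≤ ψ₀ _
    rw [hψ₀ _ (IsSelfAdjoint.star_mul_self a), Complex.real_le_real]
    have h1 := hg (star a * a, ‖φ a‖ ^ 2) (mem_dominationCone.2
      ⟨Unit, inferInstance, fun _ => a, by
        simp [(IsSelfAdjoint.star_mul_self a).coe_realPart], by simp⟩)
    have h2 := hgj (0, ‖φ a‖ ^ 2)
    simp only [hj, zero_smul, mul_zero, zero_sub] at h2
    have h3 : (star a * a, ‖φ a‖ ^ 2) = ((star a * a, 0) : B × ℝ) + (0, ‖φ a‖ ^ 2) := by simp
    rw [h3, map_add, h2] at h1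
    change _ ≤ g (star a * a, 0)
    linarith

end Dominating

section VectorFunctional

variable {B : Type*} [NonUnitalCStarAlgebra B]
variable {H : Type*} [NormedAddCommGroup H] [InnerProductSpace ℂ H] [CompleteSpace H]

/-- The vector functional `b ↦ ⟪ζ, π(b) η⟫` of a representation `π`. -/
noncomputable def vectorFunctional (π : B →⋆ₙₐ[ℂ] (H →L[ℂ] H)) (ζ η : H) : StrongDual ℂ B :=
  LinearMap.mkContinuous
    { toFun := fun b => ⟪ζ, π b η⟫_ℂ
      map_add' := fun a b => by simp
      map_smul' := fun c b => by simp } (‖ζ‖ * ‖η‖)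
    fun b => by
      calc ‖⟪ζ, π b η⟫_ℂ‖ ≤ ‖ζ‖ * ‖π b η‖ := norm_inner_le_norm _ _
        _ ≤ ‖ζ‖ * (‖b‖ * ‖η‖) := by
          gcongr
          refine ((π b).le_opNorm η).trans ?_
          gcongr
          exact NonUnitalStarAlgHom.norm_apply_le π b
        _ = ‖ζ‖ * ‖η‖ * ‖b‖ := by ring

theorem vectorFunctional_apply (π : B →⋆ₙₐ[ℂ] (H →L[ℂ] H)) (ζ η : H) (b : B) :
    vectorFunctional π ζ η b = ⟪ζ, π b η⟫_ℂ := rfl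

theorem norm_vectorFunctional_le (π : B →⋆ₙₐ[ℂ] (H →L[ℂ] H)) (ζ η : H) :
    ‖vectorFunctional π ζ η‖ ≤ ‖ζ‖ * ‖η‖ :=
  LinearMap.mkContinuous_norm_le _ (by positivity) _

end VectorFunctional

/-- The unital case of `exists_vectorFunctional_eq`: in the GNS representation of a positive
functional that dominates `φ`, the functional `φ` is bounded for the norm of the Hilbert space. -/
theorem exists_gns_vectorFunctional {B : Type u} [CStarAlgebra B] [Nontrivial B]
    (φ : StrongDual ℂ B) :
    ∃ (H : Type u) (_ : NormedAddCommGroup H) (_ : InnerProductSpace ℂ H) (_ : CompleteSpace H)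
      (π : B →⋆ₙₐ[ℂ] (H →L[ℂ] H)) (ζ η : H),
      ‖ζ‖ ≤ 1 ∧ ‖η‖ ≤ ‖φ‖ ∧ ∀ b, φ b = ⟪ζ, π b η⟫_ℂ := by
  let _ : PartialOrder B := CStarAlgebra.spectralOrder B
  have : StarOrderedRing B := CStarAlgebra.spectralOrderedRing B
  obtain ⟨ψ, hψ1, hψ⟩ := exists_positive_dominating φ
  have hbound : ∀ a : ψ.PreGNS, ‖φ (ψ.ofPreGNS a)‖ ≤ 1 * ‖a‖ := by
    intro a
    rw [one_mul]
    refine le_of_sq_le_sq ?_ (norm_nonneg _)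
    have h := hψ (ψ.ofPreGNS a)
    rw [← ψ.preGNS_norm_sq] at h
    exact_mod_cast h
  let F : StrongDual ℂ ψ.PreGNS :=
    LinearMap.mkContinuous (φ.toLinearMap ∘ₗ ψ.ofPreGNS.toLinearMap) 1 hbound
  let e : ψ.PreGNS →L[ℂ] ψ.GNS := UniformSpace.Completion.toComplL
  have hde : DenseRange e := UniformSpace.Completion.denseRange_coe
  have hue : IsUniformInducing e := UniformSpace.Completion.isUniformInducing_coe _
  let F' : StrongDual ℂ ψ.GNS := F.extend e
  have hF' : ∀ a, F' (e a) = φ (ψ.ofPreGNS a) := fun a => F.extend_eq hde hue a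
  refine ⟨ψ.GNS, inferInstance, inferInstance, inferInstance, ψ.gnsNonUnitalStarAlgHom,
    (InnerProductSpace.toDual ℂ ψ.GNS).symm F', e (ψ.toPreGNS 1), ?_, ?_, fun b => ?_⟩
  · rw [LinearIsometryEquiv.norm_map]
    refine ContinuousLinearMap.opNorm_le_bound _ zero_le_one fun x => ?_
    refine UniformSpace.Completion.induction_on x
      (isClosed_le (by fun_prop) (by fun_prop)) fun a => ?_
    have h := hbound a
    rw [← hF'] at h
    rwa [UniformSpace.Completion.norm_coe]
  · have h : ‖e (ψ.toPreGNS 1)‖ = ‖ψ.toPreGNS 1‖ := UniformSpace.Completion.norm_coe _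
    rw [h]
    refine le_of_sq_le_sq ?_ (norm_nonneg _)
    have h2 := ψ.preGNS_norm_sq (ψ.toPreGNS 1)
    rw [ψ.ofPreGNS_toPreGNS, star_one, one_mul, hψ1] at h2
    exact_mod_cast h2.le
  · rw [InnerProductSpace.toDual_symm_apply]
    have h : ψ.gnsNonUnitalStarAlgHom b (e (ψ.toPreGNS 1)) = e (ψ.toPreGNS b) := by
      refine (ψ.gnsNonUnitalStarAlgHom_apply_coe).trans ?_
      rw [ψ.leftMulMapPreGNS_apply]
      simp [e]
    rw [h, hF', ψ.ofPreGNS_toPreGNS]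

/-- The Hahn–Banach theorem for a subspace that is given by a linear isometry. -/
theorem exists_extension_along_isometry {E F : Type*} [NormedAddCommGroup E] [NormedSpace ℂ E]
    [NormedAddCommGroup F] [NormedSpace ℂ F] (j : E →ₗᵢ[ℂ] F) (φ : StrongDual ℂ E) :
    ∃ Φ : StrongDual ℂ F, (∀ x, Φ (j x) = φ x) ∧ ‖Φ‖ ≤ ‖φ‖ := by
  obtain ⟨Φ, hΦ, hΦn⟩ := exists_extension_norm_eq (LinearMap.range j.toLinearMap)
    (φ.comp (j.equivRange.symm.toContinuousLinearEquiv : _ →L[ℂ] E))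
  refine ⟨Φ, fun x => (hΦ (j.equivRange x)).trans
    (congrArg φ (j.equivRange.symm_apply_apply x)), ?_⟩
  rw [hΦn]
  refine ContinuousLinearMap.opNorm_le_bound _ (norm_nonneg _) fun z => ?_
  refine (φ.le_opNorm _).trans (le_of_eq ?_)
  congr 1
  exact j.equivRange.symm.norm_map z

/-- Every bounded functional on a C*-algebra is a vector functional of some representation, with
vectors of the optimal norm. -/
theorem exists_vectorFunctional_eq {B : Type u} [NonUnitalCStarAlgebra B] (φ : StrongDual ℂ B) :
    ∃ (H : Type u) (_ : NormedAddCommGroup H) (_ : InnerProductSpace ℂ H) (_ : CompleteSpace H)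
      (π : B →⋆ₙₐ[ℂ] (H →L[ℂ] H)) (ζ η : H),
      ‖ζ‖ ≤ 1 ∧ ‖η‖ ≤ ‖φ‖ ∧ φ = vectorFunctional π ζ η := by
  let j : B →ₗᵢ[ℂ] Unitization ℂ B :=
    ⟨⟨⟨Unitization.inr, Unitization.inr_add ℂ⟩, Unitization.inr_smul ℂ⟩,
      fun b => Unitization.norm_inr (𝕜 := ℂ) b⟩
  obtain ⟨Φ, hΦφ, hn⟩ := exists_extension_along_isometry j φ
  obtain ⟨H, _, _, _, π, ζ, η, hζ, hη, h⟩ := exists_gns_vectorFunctional Φ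
  refine ⟨H, inferInstance, inferInstance, inferInstance,
    π.comp (Unitization.inrNonUnitalStarAlgHom ℂ B), ζ, η, hζ, hη.trans hn, ?_⟩
  ext b
  rw [← hΦφ]
  exact h _

/-! ### The bidual is a C*-algebra -/

section BidualRep

variable {B : Type*} [NonUnitalCStarAlgebra B]

theorem Bidual.le_norm (x : Bidual B) (φ : StrongDual ℂ B) : ‖x φ‖ ≤ ‖x‖ * ‖φ‖ :=
  ContinuousLinearMap.le_opNorm (show StrongDual ℂ (StrongDual ℂ B) from x) φ

theorem Bidual.norm_le {x : Bidual B} {C : ℝ} (hC : 0 ≤ C)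
    (h : ∀ φ : StrongDual ℂ B, ‖x φ‖ ≤ C * ‖φ‖) : ‖x‖ ≤ C :=
  ContinuousLinearMap.opNorm_le_bound (show StrongDual ℂ (StrongDual ℂ B) from x) hC h

theorem Bidual.map_add (x : Bidual B) (φ ψ : StrongDual ℂ B) : x (φ + ψ) = x φ + x ψ :=
  ContinuousLinearMap.map_add (show StrongDual ℂ (StrongDual ℂ B) from x) φ ψ

theorem Bidual.map_smul (x : Bidual B) (c : ℂ) (φ : StrongDual ℂ B) : x (c • φ) = c * x φ :=
  ContinuousLinearMap.map_smul (show StrongDual ℂ (StrongDual ℂ B) from x) c φ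

variable {H : Type*} [NormedAddCommGroup H] [InnerProductSpace ℂ H] [CompleteSpace H]
  (π : B →⋆ₙₐ[ℂ] (H →L[ℂ] H))

/-- The extension of a representation `π` of `B` to the bidual, which is characterized by
`⟪ζ, π(x) η⟫ = x ⟪ζ, π(·) η⟫`. -/
noncomputable def bidualRep (x : Bidual B) : H →L[ℂ] H :=
  ContinuousLinearMap.adjoint <| InnerProductSpace.continuousLinearMapOfBilin <|
    LinearMap.mkContinuous₂
      (LinearMap.mk₂'ₛₗ (starRingEnd ℂ) (RingHom.id ℂ) (fun ζ η => x (vectorFunctional π ζ η))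
        (fun ζ ζ' η => by
          rw [← Bidual.map_add]; congr 1; ext b; simp [vectorFunctional_apply])
        (fun c ζ η => by
          rw [smul_eq_mul, ← Bidual.map_smul]; congr 1; ext b
          simp [vectorFunctional_apply, mul_comm])
        (fun ζ η η' => by
          rw [← Bidual.map_add]; congr 1; ext b; simp [vectorFunctional_apply])
        (fun c ζ η => by
          rw [smul_eq_mul, RingHom.id_apply, ← Bidual.map_smul]; congr 1; ext b
          simp [vectorFunctional_apply])) ‖x‖
      fun ζ η => (x.le_norm _).trans <| by
        rw [mul_assoc]
        exact mul_le_mul_of_nonneg_left (norm_vectorFunctional_le π ζ η) (norm_nonneg _)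

theorem inner_bidualRep (x : Bidual B) (ζ η : H) :
    ⟪ζ, bidualRep π x η⟫_ℂ = x (vectorFunctional π ζ η) := by
  rw [bidualRep, ContinuousLinearMap.adjoint_inner_right,
    InnerProductSpace.continuousLinearMapOfBilin_apply]
  rfl

theorem norm_bidualRep_le (x : Bidual B) : ‖bidualRep π x‖ ≤ ‖x‖ := by
  refine ContinuousLinearMap.opNorm_le_bound _ (norm_nonneg _) fun η => ?_
  set ζ := bidualRep π x η with hζ
  have h1 : ‖ζ‖ * ‖ζ‖ ≤ ‖x‖ * (‖ζ‖ * ‖η‖) := by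
    rw [← inner_self_eq_norm_mul_norm (𝕜 := ℂ)]
    refine (RCLike.re_le_norm _).trans ?_
    nth_rewrite 2 [hζ]
    rw [inner_bidualRep]
    exact (x.le_norm _).trans
      (mul_le_mul_of_nonneg_left (norm_vectorFunctional_le π ζ η) (norm_nonneg _))
  rcases (norm_nonneg ζ).eq_or_lt with h0 | h0
  · rw [← h0]; positivity
  · refine le_of_mul_le_mul_left (h1.trans_eq ?_) h0
    ring

theorem bidualRep_mul (x y : Bidual B) :
    bidualRep π (x * y) = bidualRep π x * bidualRep π y := by
  ext η
  refine ext_inner_left ℂ fun ζ => ?_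
  rw [inner_bidualRep, mul_apply_eq_comp, inner_bidualRep, Bidual.mul_apply]
  congr 1
  ext a
  rw [bidualMulDual_apply, vectorFunctional_apply,
    ← ContinuousLinearMap.adjoint_inner_left (π a), inner_bidualRep]
  congr 1
  ext b
  rw [dualMulRight_apply, vectorFunctional_apply, vectorFunctional_apply, map_mul,
    ContinuousLinearMap.adjoint_inner_left, mul_apply_eq_comp]

theorem dualStar_vectorFunctional (ζ η : H) :
    dualStar (vectorFunctional π ζ η) = vectorFunctional π η ζ := by
  ext b
  rw [dualStar_apply, vectorFunctional_apply, vectorFunctional_apply, map_star,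
    ContinuousLinearMap.star_eq_adjoint, ContinuousLinearMap.adjoint_inner_right]
  exact inner_conj_symm _ _

theorem bidualRep_star (x : Bidual B) : bidualRep π (star x) = star (bidualRep π x) := by
  ext η
  refine ext_inner_left ℂ fun ζ => ?_
  rw [inner_bidualRep, ContinuousLinearMap.star_eq_adjoint,
    ContinuousLinearMap.adjoint_inner_right, Bidual.star_apply, dualStar_vectorFunctional,
    ← inner_bidualRep]
  exact inner_conj_symm _ _

end BidualRep

section BidualCStar

variable {B : Type*} [NonUnitalCStarAlgebra B]

/-- The representations of `B` separate the points of the bidual. -/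
theorem Bidual.ext_bidualRep {B : Type u} [NonUnitalCStarAlgebra B] {x y : Bidual B}
    (h : ∀ (H : Type u) [NormedAddCommGroup H] [InnerProductSpace ℂ H] [CompleteSpace H]
      (π : B →⋆ₙₐ[ℂ] (H →L[ℂ] H)), bidualRep π x = bidualRep π y) : x = y := by
  refine DFunLike.ext _ _ fun φ => ?_
  obtain ⟨H, _, _, _, π, ζ, η, -, -, rfl⟩ := exists_vectorFunctional_eq φ
  rw [← inner_bidualRep, ← inner_bidualRep, h]

/-- The C*-inequality in the bidual. It holds in every representation, and a functional `φ` is a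
vector functional of some representation, with vectors of norms at most `1` and `‖φ‖`. -/
theorem Bidual.norm_mul_self_le (x : Bidual B) : ‖x‖ * ‖x‖ ≤ ‖star x * x‖ := by
  have h : ‖x‖ ≤ √‖star x * x‖ := by
    refine Bidual.norm_le (Real.sqrt_nonneg _) fun φ => ?_
    obtain ⟨H, _, _, _, π, ζ, η, hζ, hη, h⟩ := exists_vectorFunctional_eq φ
    have hx : ‖bidualRep π x‖ ≤ √‖star x * x‖ := by
      refine Real.le_sqrt_of_sq_le ?_
      rw [sq, ← CStarRing.norm_star_mul_self, ← bidualRep_star, ← bidualRep_mul]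
      exact norm_bidualRep_le π _
    have hxφ : x φ = ⟪ζ, bidualRep π x η⟫_ℂ := by rw [inner_bidualRep, ← h]
    rw [hxφ]
    calc ‖⟪ζ, bidualRep π x η⟫_ℂ‖ ≤ ‖ζ‖ * ‖bidualRep π x η‖ := norm_inner_le_norm _ _
      _ ≤ 1 * (‖bidualRep π x‖ * ‖η‖) := by
        gcongr
        exact (bidualRep π x).le_opNorm η
      _ ≤ 1 * (√‖star x * x‖ * ‖φ‖) := by gcongr
      _ = √‖star x * x‖ * ‖φ‖ := one_mul _
  calc ‖x‖ * ‖x‖ ≤ √‖star x * x‖ * √‖star x * x‖ := mul_self_le_mul_self (norm_nonneg _) h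
    _ = _ := Real.mul_self_sqrt (norm_nonneg _)

theorem Bidual.norm_mul_le (x y : Bidual B) : ‖x * y‖ ≤ ‖x‖ * ‖y‖ := by
  refine Bidual.norm_le (by positivity) fun φ => ?_
  have h : ‖bidualMulDual y φ‖ ≤ ‖y‖ * ‖φ‖ :=
    ContinuousLinearMap.le_of_opNorm_le _ (LinearMap.mkContinuous_norm_le _ (norm_nonneg _) _) φ
  rw [Bidual.mul_apply, mul_assoc]
  exact (x.le_norm _).trans (mul_le_mul_of_nonneg_left h (norm_nonneg _))

theorem Bidual.mul_add (x y z : Bidual B) : x * (y + z) = x * y + x * z :=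
  DFunLike.ext _ _ fun φ => x.map_add (bidualMulDual y φ) (bidualMulDual z φ)

theorem Bidual.star_add (x y : Bidual B) : star (x + y) = star x + star y :=
  DFunLike.ext _ _ fun φ => StarAddMonoid.star_add (x (dualStar φ)) (y (dualStar φ))

theorem Bidual.star_smul (c : ℂ) (x : Bidual B) : star (c • x) = star c • star x :=
  DFunLike.ext _ _ fun φ => _root_.star_mul' c (x (dualStar φ))

noncomputable instance : NonUnitalRing (Bidual B) :=
  { (inferInstance : AddCommGroup (Bidual B)), (inferInstance : Mul (Bidual B)) with
    left_distrib := Bidual.mul_add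
    right_distrib := fun _ _ _ => rfl
    zero_mul := fun _ => rfl
    mul_zero := fun x => DFunLike.ext _ _ fun φ =>
      ContinuousLinearMap.map_zero (show StrongDual ℂ (StrongDual ℂ B) from x)
    mul_assoc := fun x y z => Bidual.ext_bidualRep fun H _ _ _ π => by
      simp only [bidualRep_mul, mul_assoc] }

noncomputable instance : NonUnitalNormedRing (Bidual B) :=
  { (inferInstance : NormedAddCommGroup (Bidual B)), (inferInstance : NonUnitalRing (Bidual B)) with
    norm_mul_le := Bidual.norm_mul_le }

noncomputable instance : StarRing (Bidual B) where
  star_involutive x := Bidual.ext_bidualRep fun H _ _ _ π => by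
    rw [bidualRep_star, bidualRep_star, star_star]
  star_mul x y := Bidual.ext_bidualRep fun H _ _ _ π => by
    rw [bidualRep_star, bidualRep_mul, bidualRep_mul, bidualRep_star, bidualRep_star, star_mul]
  star_add := Bidual.star_add

instance : CompleteSpace (Bidual B) :=
  inferInstanceAs (CompleteSpace (StrongDual ℂ (StrongDual ℂ B)))

/-- The bidual of a C*-algebra, with the Arens product, is a C*-algebra. -/
noncomputable instance : NonUnitalCStarAlgebra (Bidual B) where
  smul_assoc _ _ _ := rfl
  smul_comm c x _ := DFunLike.ext _ _ fun _ => (x.map_smul c _).symm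
  star_smul c x := Bidual.star_smul c x
  norm_smul_le := norm_smul_le
  norm_mul_self_le := Bidual.norm_mul_self_le

end BidualCStar

/-! ### Norms in a C*-algebra -/

section Orthogonal

variable {M : Type*} [NonUnitalCStarAlgebra M]

theorem norm_add_pow_le_of_mul_eq_zero (n : ℕ) : ∀ {x y : M}, IsSelfAdjoint x → IsSelfAdjoint y →
    x * y = 0 → ‖x + y‖ ^ 2 ^ n ≤ ‖x‖ ^ 2 ^ n + ‖y‖ ^ 2 ^ n := by
  induction n with
  | zero => intro x y _ _ _; simpa using norm_add_le x y
  | succ n ih =>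
    intro x y hx hy hxy
    have hyx : y * x = 0 := by
      rw [← hx.star_eq, ← hy.star_eq, ← star_mul, hxy, star_zero]
    have hsq : (x + y) * (x + y) = x * x + y * y := by
      rw [add_mul, mul_add, mul_add, hxy, hyx, add_zero, zero_add]
    have h0 : (x * x) * (y * y) = 0 := by
      rw [mul_assoc, ← mul_assoc x y y, hxy, zero_mul, mul_zero]
    have hxx : IsSelfAdjoint (x * x) := by rw [isSelfAdjoint_iff, star_mul, hx.star_eq]
    have hyy : IsSelfAdjoint (y * y) := by rw [isSelfAdjoint_iff, star_mul, hy.star_eq]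
    have h := ih hxx hyy h0
    rw [← hsq, (hx.add hy).norm_mul_self, hx.norm_mul_self, hy.norm_mul_self] at h
    simpa only [pow_succ', pow_mul] using h

/-- The norm of an orthogonal sum of self-adjoint elements is at most the maximum of their norms. -/
theorem norm_add_le_of_mul_eq_zero {x y : M} (hx : IsSelfAdjoint x) (hy : IsSelfAdjoint y)
    (hxy : x * y = 0) {C : ℝ} (hxC : ‖x‖ ≤ C) (hyC : ‖y‖ ≤ C) : ‖x + y‖ ≤ C := by
  have hC0 : 0 ≤ C := (norm_nonneg x).trans hxC
  rcases hC0.eq_or_lt with h0 | h0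
  · have := norm_add_le x y
    linarith
  by_contra! hlt
  obtain ⟨n, hn⟩ := pow_unbounded_of_one_lt 2 ((one_lt_div h0).2 hlt)
  have h1 : (‖x + y‖ / C) ^ 2 ^ n ≤ 2 := by
    rw [div_pow, div_le_iff₀ (by positivity)]
    calc ‖x + y‖ ^ 2 ^ n ≤ ‖x‖ ^ 2 ^ n + ‖y‖ ^ 2 ^ n := norm_add_pow_le_of_mul_eq_zero n hx hy hxy
      _ ≤ C ^ 2 ^ n + C ^ 2 ^ n := by gcongr
      _ = 2 * C ^ 2 ^ n := by ring
  have h2 : (‖x + y‖ / C) ^ n ≤ (‖x + y‖ / C) ^ 2 ^ n :=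
    pow_le_pow_right₀ ((one_lt_div h0).2 hlt).le Nat.lt_two_pow_self.le
  linarith

theorem norm_le_one_of_isStarProjection {q : M} (hq : IsStarProjection q) : ‖q‖ ≤ 1 := by
  have h := hq.isSelfAdjoint.norm_mul_self
  rw [hq.isIdempotentElem.eq] at h
  nlinarith [norm_nonneg q]

end Orthogonal

/-! ### Functoriality of the sequence algebra and of the bidual -/

section Functoriality

variable {A B C : Type*} [NonUnitalCStarAlgebra A] [NonUnitalCStarAlgebra B]
  [NonUnitalCStarAlgebra C]

namespace SeqAlg

theorem map_comp (S : B →L[ℂ] C) (T : A →L[ℂ] B) : map (S.comp T) = (map S).comp (map T) := by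
  ext x
  obtain ⟨x, rfl⟩ := mk_surjective x
  rfl

theorem map_sub (S T : A →L[ℂ] B) : map (S - T) = map S - map T := by
  ext x
  obtain ⟨x, rfl⟩ := mk_surjective x
  rfl

theorem map_mul {T : A →L[ℂ] B} (hT : ∀ a b, T (a * b) = T a * T b) (x y : SeqAlg A) :
    map T (x * y) = map T x * map T y := by
  obtain ⟨x, rfl⟩ := mk_surjective x
  obtain ⟨y, rfl⟩ := mk_surjective y
  rw [← mk_mul, map_mk, map_mk, map_mk, ← mk_mul]
  exact congrArg mk (lp.ext (funext fun n => hT (x n) (y n)))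

theorem map_star {T : A →L[ℂ] B} (hT : ∀ a, T (star a) = star (T a)) (x : SeqAlg A) :
    map T (star x) = star (map T x) := by
  obtain ⟨x, rfl⟩ := mk_surjective x
  rw [← mk_star, map_mk, map_mk, ← mk_star]
  exact congrArg mk (lp.ext (funext fun n => hT (x n)))

theorem norm_map_le (T : A →L[ℂ] B) : ‖map T‖ ≤ ‖T‖ := by
  refine ContinuousLinearMap.opNorm_le_bound _ (norm_nonneg _) fun x => ?_
  have key : ∀ ε > 0, ‖map T x‖ ≤ ‖T‖ * (‖x‖ + ε) := by
    intro ε hε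
    obtain ⟨a, rfl, ha⟩ := exists_norm_lt x hε
    rw [map_mk]
    refine (norm_mk_le _).trans (lp.norm_le_of_forall_le (by positivity) fun n => ?_)
    refine (T.le_opNorm (a n)).trans (mul_le_mul_of_nonneg_left ?_ (norm_nonneg _))
    exact (lp.norm_apply_le_norm (by simp) a n).trans ha.le
  have hlim : Tendsto (fun ε : ℝ => ‖T‖ * (‖x‖ + ε)) (𝓝[>] 0) (𝓝 (‖T‖ * ‖x‖)) := by
    have : Continuous fun ε : ℝ => ‖T‖ * (‖x‖ + ε) := by fun_prop
    simpa using (this.tendsto 0).mono_left nhdsWithin_le_nhds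
  exact ge_of_tendsto hlim (eventually_mem_nhdsWithin.mono fun ε hε => key ε hε)

theorem norm_map_of_isometry {T : A →L[ℂ] B} (hT : ∀ a, ‖T a‖ = ‖a‖) (x : SeqAlg A) :
    ‖map T x‖ = ‖x‖ := by
  refine le_antisymm ?_ ?_
  · have h1 : ‖T‖ ≤ 1 :=
      ContinuousLinearMap.opNorm_le_bound _ zero_le_one fun a => by rw [hT, one_mul]
    simpa using (map T).le_of_opNorm_le ((norm_map_le T).trans h1) x
  · refine le_of_forall_pos_le_add fun ε hε => ?_
    obtain ⟨x, rfl⟩ := mk_surjective x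
    obtain ⟨y, hy, hyn⟩ := exists_norm_lt (map T (mk x)) (half_pos hε)
    rw [map_mk] at hy hyn ⊢
    have hd : y - lInftyMap T x ∈ cZero B := (Submodule.Quotient.eq (cZero B)).1 hy
    refine norm_mk_le_of_eventually x (by positivity) ?_
    filter_upwards [(mem_cZero.1 hd).eventually (gt_mem_nhds (half_pos hε))] with n hn
    have h1 : (y - lInftyMap T x) n = y n - T (x n) := rfl
    have h2 : ‖y n‖ ≤ ‖y‖ := lp.norm_apply_le_norm (by simp) y n
    have h3 : ‖T (x n)‖ ≤ ‖y n‖ + ‖y n - T (x n)‖ := by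
      simpa using norm_sub_le (y n) (y n - T (x n))
    rw [hT] at h3
    rw [h1] at hn
    linarith

end SeqAlg

theorem bidualMap_comp (S : B →L[ℂ] C) (T : A →L[ℂ] B) (x : Bidual A) :
    bidualMap (S.comp T) x = bidualMap S (bidualMap T x) := rfl

theorem bidualMap_sub (T : A →L[ℂ] B) (x y : Bidual A) :
    bidualMap T (x - y) = bidualMap T x - bidualMap T y := rfl

theorem bidualMap_map_sub (S T : A →L[ℂ] B) (x : Bidual A) :
    bidualMap (S - T) x = bidualMap S x - bidualMap T x := by
  refine DFunLike.ext _ _ fun φ => ?_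
  have h : φ.comp (S - T) = φ.comp S - φ.comp T := by ext; simp
  have h2 : x (φ.comp S - φ.comp T) = x (φ.comp S) - x (φ.comp T) :=
    ContinuousLinearMap.map_sub (show StrongDual ℂ (StrongDual ℂ A) from x) _ _
  rw [bidualMap_apply, h, h2]
  rfl

theorem bidualMap_mul {T : A →L[ℂ] B} (hT : ∀ a b, T (a * b) = T a * T b) (x y : Bidual A) :
    bidualMap T (x * y) = bidualMap T x * bidualMap T y := by
  refine DFunLike.ext _ _ fun φ => ?_
  rw [bidualMap_apply, Bidual.mul_apply, Bidual.mul_apply, bidualMap_apply]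
  congr 1
  ext a
  rw [bidualMulDual_apply, ContinuousLinearMap.comp_apply, bidualMulDual_apply, bidualMap_apply]
  congr 1
  ext b
  exact congrArg φ (hT a b)

theorem bidualMap_star {T : A →L[ℂ] B} (hT : ∀ a, T (star a) = star (T a)) (x : Bidual A) :
    bidualMap T (star x) = star (bidualMap T x) := by
  refine DFunLike.ext _ _ fun φ => ?_
  rw [bidualMap_apply, Bidual.star_apply, Bidual.star_apply, bidualMap_apply]
  congr 2
  ext a
  simp [dualStar_apply, hT]

theorem norm_bidualMap_le (T : A →L[ℂ] B) (x : Bidual A) : ‖bidualMap T x‖ ≤ ‖T‖ * ‖x‖ := by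
  refine Bidual.norm_le (by positivity) fun φ => ?_
  rw [bidualMap_apply]
  calc ‖x (φ.comp T)‖ ≤ ‖x‖ * (‖φ‖ * ‖T‖) :=
        (x.le_norm _).trans (mul_le_mul_of_nonneg_left (φ.opNorm_comp_le T) (norm_nonneg _))
    _ = ‖T‖ * ‖x‖ * ‖φ‖ := by ring

/-- The bidual of an isometry is an isometry, because functionals on the range extend to functionals
of the same norm. -/
theorem norm_bidualMap_of_isometry {T : A →L[ℂ] B} (hT : ∀ a, ‖T a‖ = ‖a‖) (x : Bidual A) :
    ‖bidualMap T x‖ = ‖x‖ := by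
  have h1 : ‖T‖ ≤ 1 :=
    ContinuousLinearMap.opNorm_le_bound _ zero_le_one fun a => by rw [hT, one_mul]
  refine le_antisymm ((norm_bidualMap_le T x).trans
    (mul_le_of_le_one_left (norm_nonneg _) h1)) ?_
  refine Bidual.norm_le (norm_nonneg _) fun φ => ?_
  obtain ⟨Φ, hΦ, hn⟩ := exists_extension_along_isometry ⟨T.toLinearMap, hT⟩ φ
  have hΦφ : Φ.comp T = φ := ContinuousLinearMap.ext hΦ
  rw [← hΦφ, ← bidualMap_apply]
  refine ((bidualMap T x).le_norm Φ).trans (mul_le_mul_of_nonneg_left ?_ (norm_nonneg _))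
  rwa [hΦφ]

theorem incl_mul (a b : A) : incl (a * b) = incl a * incl b := rfl

theorem incl_star (a : A) : incl (star a) = star (incl a) := toBidual_star (SeqAlg.const a)

/-- The map `y ↦ c y d`. -/
noncomputable def sandwich (c d : A) : A →L[ℂ] A :=
  ((ContinuousLinearMap.mul ℂ A).flip d).comp (ContinuousLinearMap.mul ℂ A c)

theorem bidualMap_sandwich (c d : A) (x : Bidual (SeqAlg A)) :
    bidualMap (SeqAlg.map (sandwich c d)) x = incl c * x * incl d := by
  have h : SeqAlg.map (sandwich c d) = sandwich (SeqAlg.const c) (SeqAlg.const d) := by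
    ext y
    obtain ⟨y, rfl⟩ := SeqAlg.mk_surjective y
    rfl
  rw [h]
  refine DFunLike.ext _ _ fun φ => ?_
  rfl

end Functoriality

/-! ### Translates of the Rokhlin projection -/

section Translates

variable {A : Type*} [NonUnitalCStarAlgebra A] {G : Type*} [Group G]

theorem autCLM_apply (σ : A ≃⋆ₐ[ℂ] A) (a : A) : autCLM σ a = σ a := rfl

theorem norm_autCLM_apply (σ : A ≃⋆ₐ[ℂ] A) (a : A) : ‖autCLM σ a‖ = ‖a‖ :=
  NonUnitalStarAlgHom.norm_map σ (EquivLike.injective σ) a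

variable (α : G →* (A ≃⋆ₐ[ℂ] A))

theorem bidualAct_mul (t : G) (x y : Bidual (SeqAlg A)) :
    bidualAct α t (x * y) = bidualAct α t x * bidualAct α t y :=
  bidualMap_mul (SeqAlg.map_mul fun a b => map_mul (α t) a b) x y

theorem bidualAct_star (t : G) (x : Bidual (SeqAlg A)) :
    bidualAct α t (star x) = star (bidualAct α t x) :=
  bidualMap_star (SeqAlg.map_star fun a => map_star (α t) a) x

theorem bidualAct_zero (t : G) : bidualAct α t 0 = 0 := rfl

theorem bidualAct_incl (t : G) (a : A) : bidualAct α t (incl a) = incl (α t a) := rfl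

theorem bidualAct_bidualAct (s t : G) (x : Bidual (SeqAlg A)) :
    bidualAct α s (bidualAct α t x) = bidualAct α (s * t) x := by
  have h : autCLM (α (s * t)) = (autCLM (α s)).comp (autCLM (α t)) := by
    ext a
    rw [ContinuousLinearMap.comp_apply, autCLM_apply, autCLM_apply, autCLM_apply, map_mul]
    rfl
  rw [bidualAct, bidualAct, bidualAct, h, SeqAlg.map_comp, bidualMap_comp]

theorem isStarProjection_bidualAct {p : Bidual (SeqAlg A)} (hp : IsStarProjection p) (t : G) :
    IsStarProjection (bidualAct α t p) where
  isIdempotentElem := by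
    rw [IsIdempotentElem, ← bidualAct_mul, hp.isIdempotentElem.eq]
  isSelfAdjoint := by
    rw [isSelfAdjoint_iff, ← bidualAct_star, hp.isSelfAdjoint.star_eq]

theorem commute_bidualAct {p : Bidual (SeqAlg A)} (hp : ∀ a : A, incl a * p = p * incl a) (t : G)
    (a : A) : Commute (incl a) (bidualAct α t p) := by
  have h : α t (α t⁻¹ a) = a := by
    rw [map_inv]; exact (α t).apply_symm_apply a
  rw [Commute, SemiconjBy, ← h, ← bidualAct_incl, ← bidualAct_mul, ← bidualAct_mul, hp]

theorem bidualAct_mul_bidualAct_eq_zero {p : Bidual (SeqAlg A)}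
    (hp : ∀ t : G, t ≠ 1 → p * bidualAct α t p = 0) {s t : G} (hst : s ≠ t) :
    bidualAct α s p * bidualAct α t p = 0 := by
  have h := hp (s⁻¹ * t) (by rwa [Ne, inv_mul_eq_one])
  have h2 := congrArg (bidualAct α s) h
  rwa [bidualAct_mul, bidualAct_bidualAct, mul_inv_cancel_left, bidualAct_zero] at h2

end Translates

/-! ### Multipliers and the map `α_t|_I - Ad(u)` -/

section Multiplier

variable {B : Type*} [NonUnitalCStarAlgebra B]

theorem multiplier_fst_mul (m : 𝓜(ℂ, B)) (y z : B) : m.fst (y * z) = m.fst y * z := by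
  have h : ∀ w : B, w * (m.fst (y * z) - m.fst y * z) = 0 := fun w => by
    rw [mul_sub, ← m.central, ← mul_assoc, m.central, mul_assoc, sub_self]
  rw [← sub_eq_zero, ← CStarRing.star_mul_self_eq_zero_iff, h]

theorem multiplier_snd_mul (m : 𝓜(ℂ, B)) (y z : B) : m.snd (y * z) = y * m.snd z := by
  have h : ∀ w : B, (m.snd (y * z) - y * m.snd z) * w = 0 := fun w => by
    rw [sub_mul, m.central, mul_assoc, ← m.central, mul_assoc, sub_self]
  rw [← sub_eq_zero, ← CStarRing.mul_star_self_eq_zero_iff, h]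

theorem unitary_fst_star_fst (u : unitary 𝓜(ℂ, B)) (x : B) :
    (u : 𝓜(ℂ, B)).fst ((star (u : 𝓜(ℂ, B))).fst x) = x := by
  exact congrArg (fun m : 𝓜(ℂ, B) => m.fst x) (Unitary.mul_star_self_of_mem u.2)

theorem unitary_star_snd_snd (u : unitary 𝓜(ℂ, B)) (x : B) :
    (star (u : 𝓜(ℂ, B))).snd ((u : 𝓜(ℂ, B)).snd x) = x := by
  exact congrArg (fun m : 𝓜(ℂ, B) => m.snd x) (Unitary.mul_star_self_of_mem u.2)

theorem innerAut_mul (u : unitary 𝓜(ℂ, B)) (c y : B) :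
    innerAut u (c * y) = (u : 𝓜(ℂ, B)).fst c * (star (u : 𝓜(ℂ, B))).snd y := by
  change (star (u : 𝓜(ℂ, B))).snd ((u : 𝓜(ℂ, B)).fst (c * y)) = _
  rw [multiplier_fst_mul, multiplier_snd_mul]

theorem norm_innerAut_le (u : unitary 𝓜(ℂ, B)) : ‖innerAut u‖ ≤ 1 := by
  have h1 : ‖(u : 𝓜(ℂ, B))‖ ≤ 1 := by
    rcases subsingleton_or_nontrivial 𝓜(ℂ, B) with h | h
    · rw [Subsingleton.elim (u : 𝓜(ℂ, B)) 0, norm_zero]; exact zero_le_one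
    · exact (CStarRing.norm_coe_unitary u).le
  refine (ContinuousLinearMap.opNorm_comp_le _ _).trans ?_
  rw [DoubleCentralizer.norm_fst, DoubleCentralizer.norm_snd, norm_star]
  exact mul_le_one₀ h1 (norm_nonneg _) h1

variable {A : Type*} [NonUnitalCStarAlgebra A] (I : ClosedIdeal A)

/-- The inclusion of an ideal. -/
noncomputable def idealInclusion : I →L[ℂ] A :=
  LinearMap.mkContinuous
    { toFun := fun x => (x : A), map_add' := fun _ _ => rfl, map_smul' := fun _ _ => rfl } 1
    fun x => by rw [one_mul]; exact le_rfl

theorem norm_idealInclusion (x : I) : ‖idealInclusion I x‖ = ‖x‖ := rfl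

/-- The map `y ↦ c y d` as a map into the ideal that contains `c`. -/
noncomputable def sandwichIdeal (c d : I) : A →L[ℂ] I :=
  LinearMap.mkContinuous
    { toFun := fun y => ⟨c * (y * d), I.mul_mem_left _ (I.mul_mem_left _ d.2)⟩
      map_add' := fun x y => Subtype.ext (by simp [add_mul, mul_add])
      map_smul' := fun z y => Subtype.ext (by simp [smul_mul_assoc, mul_smul_comm]) } (‖c‖ * ‖d‖)
    fun y => by
      change ‖(c : A) * (y * d)‖ ≤ ‖(c : A)‖ * ‖(d : A)‖ * ‖y‖
      calc ‖(c : A) * (y * d)‖ ≤ ‖(c : A)‖ * (‖y‖ * ‖(d : A)‖) :=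
            (norm_mul_le _ _).trans (by gcongr; exact norm_mul_le _ _)
        _ = _ := by ring

theorem idealInclusion_comp_sandwichIdeal (c d : I) :
    (idealInclusion I).comp (sandwichIdeal I c d) = sandwich (c : A) (d : A) := by
  ext y
  exact (mul_assoc _ _ _).symm

/-- On the elements `c y d` the map `σ|_I - Ad(u)` takes the value
`σ(c) σ(y) σ(d) - (u c) y (d u*)`, in which the multiplier no longer meets `y`. -/
theorem idealInclusion_comp_sub_innerAut (σ : A ≃⋆ₐ[ℂ] A) (hI : IsInvariant σ I)
    (u : unitary 𝓜(ℂ, I)) (c d : I) :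
    (idealInclusion I).comp ((restrictIdeal σ I hI - innerAut u).comp (sandwichIdeal I c d)) =
      (sandwich (σ c) (σ d)).comp (autCLM σ) -
        sandwich (((u : 𝓜(ℂ, I)).fst c : I) : A) (((star (u : 𝓜(ℂ, I))).snd d : I) : A) := by
  ext y
  have h1 : ((restrictIdeal σ I hI (sandwichIdeal I c d y) : I) : A) = σ c * σ y * σ d := by
    change σ ((c : A) * (y * d)) = _
    rw [map_mul, map_mul, mul_assoc]
  have h2 : innerAut u (sandwichIdeal I c d y)
      = (u : 𝓜(ℂ, I)).fst c * (star (u : 𝓜(ℂ, I))).snd ⟨y * d, I.mul_mem_left _ d.2⟩ :=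
    innerAut_mul u c ⟨y * d, I.mul_mem_left _ d.2⟩
  have h3 : ∀ m : 𝓜(ℂ, I), ((m.snd ⟨y * d, I.mul_mem_left _ d.2⟩ : I) : A) = y * (m.snd d : I) := by
    intro m
    have h : ∀ w : I,
        (((m.snd ⟨y * d, I.mul_mem_left _ d.2⟩ : I) : A) - y * (m.snd d : I)) * (w : A) = 0 := by
      intro w
      have e1 := congrArg (Subtype.val) (m.central ⟨y * d, I.mul_mem_left _ d.2⟩ w)
      have e2 := congrArg (Subtype.val) (m.central d w)
      change ((m.snd _ : I) : A) * w = (y * d) * (m.fst w : I) at e1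
      change ((m.snd d : I) : A) * w = d * (m.fst w : I) at e2
      rw [sub_mul, e1, mul_assoc, mul_assoc, e2, sub_self]
    rw [← sub_eq_zero, ← CStarRing.mul_star_self_eq_zero_iff]
    exact h (star ⟨_, sub_mem (m.snd ⟨y * d, I.mul_mem_left _ d.2⟩).2
      (I.mul_mem_left y (m.snd d).2)⟩)
  change ((restrictIdeal σ I hI (sandwichIdeal I c d y) : I) : A)
    - ((innerAut u (sandwichIdeal I c d y) : I) : A) = σ c * σ y * σ d - _ * y * _
  rw [h1, h2]
  congr 1
  change ((_ : I) : A) * ((_ : I) : A) = _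
  rw [h3, mul_assoc]

theorem norm_restrictIdeal_le (σ : A ≃⋆ₐ[ℂ] A) (hI : IsInvariant σ I) :
    ‖restrictIdeal σ I hI‖ ≤ 1 :=
  LinearMap.mkContinuous_norm_le _ zero_le_one _

end Multiplier

/-! ### The lower bound -/

section Main

variable {A : Type*} [NonUnitalCStarAlgebra A]

/-- The bidual extension of `σ|_I - Ad(u)`, estimated on an element that lies in the bidual of
`I_∞` because it is a difference of elements `c x d` with `c` and `d` in `I`. -/
theorem norm_bidual_sub_innerAut_le (σ : A ≃⋆ₐ[ℂ] A) (I : ClosedIdeal A) (hI : IsInvariant σ I)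
    (u : unitary 𝓜(ℂ, I)) (c d c' d' : I) (x x' : Bidual (SeqAlg A)) :
    ‖(incl (σ c) * bidualMap (SeqAlg.map (autCLM σ)) x * incl (σ d)
        - incl (((u : 𝓜(ℂ, I)).fst c : I) : A) * x *
          incl (((star (u : 𝓜(ℂ, I))).snd d : I) : A))
      - (incl (σ c') * bidualMap (SeqAlg.map (autCLM σ)) x' * incl (σ d')
        - incl (((u : 𝓜(ℂ, I)).fst c' : I) : A) * x' *
          incl (((star (u : 𝓜(ℂ, I))).snd d' : I) : A))‖
      ≤ ‖restrictIdeal σ I hI - innerAut u‖ *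
        ‖incl (c : A) * x * incl (d : A) - incl (c' : A) * x' * incl (d' : A)‖ := by
  set T := restrictIdeal σ I hI - innerAut u with hT
  let w : Bidual (SeqAlg I) := bidualMap (SeqAlg.map (sandwichIdeal I c d)) x
    - bidualMap (SeqAlg.map (sandwichIdeal I c' d')) x'
  have hι : ∀ z : Bidual (SeqAlg I), ‖bidualMap (SeqAlg.map (idealInclusion I)) z‖ = ‖z‖ :=
    norm_bidualMap_of_isometry (SeqAlg.norm_map_of_isometry (norm_idealInclusion I))
  have h1 : ∀ (a b : I) (z : Bidual (SeqAlg A)),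
      bidualMap (SeqAlg.map (idealInclusion I)) (bidualMap (SeqAlg.map (sandwichIdeal I a b)) z)
        = incl (a : A) * z * incl (b : A) := fun a b z => by
    rw [← bidualMap_comp, ← SeqAlg.map_comp, idealInclusion_comp_sandwichIdeal, bidualMap_sandwich]
  have h2 : ∀ (a b : I) (z : Bidual (SeqAlg A)),
      bidualMap (SeqAlg.map (idealInclusion I)) (bidualMap (SeqAlg.map T)
        (bidualMap (SeqAlg.map (sandwichIdeal I a b)) z))
        = incl (σ a) * bidualMap (SeqAlg.map (autCLM σ)) z * incl (σ b)
          - incl (((u : 𝓜(ℂ, I)).fst a : I) : A) * z *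
            incl (((star (u : 𝓜(ℂ, I))).snd b : I) : A) := fun a b z => by
    rw [← bidualMap_comp, ← SeqAlg.map_comp, ← bidualMap_comp, ← SeqAlg.map_comp, hT,
      ContinuousLinearMap.comp_assoc, idealInclusion_comp_sub_innerAut, SeqAlg.map_sub,
      bidualMap_map_sub, SeqAlg.map_comp, bidualMap_comp, bidualMap_sandwich, bidualMap_sandwich]
  rw [← h2, ← h2, ← h1, ← h1, ← bidualMap_sub, ← bidualMap_sub, ← bidualMap_sub, hι, hι]
  exact (norm_bidualMap_le _ w).trans
    (mul_le_mul_of_nonneg_right (SeqAlg.norm_map_le T) (norm_nonneg w))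

/-- If `q` and its translates `σ(q)`, `σ²(q)` behave like the translates of a Rokhlin projection and
`q` does not annihilate the ideal `I`, then `σ|_I` is at distance at least `2` from `Ad(u)`. -/
theorem two_le_norm_sub_innerAut (σ : A ≃⋆ₐ[ℂ] A) (I : ClosedIdeal A) (hI : IsInvariant σ I)
    (u : unitary 𝓜(ℂ, I)) {q q₁ q₂ : Bidual (SeqAlg A)}
    (hq₁ : bidualMap (SeqAlg.map (autCLM σ)) q = q₁)
    (hq₂ : bidualMap (SeqAlg.map (autCLM σ)) q₁ = q₂)
    (hq : IsStarProjection q) (hq' : IsStarProjection q₁)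
    (hc : ∀ a : A, Commute (incl a) q) (hc₁ : ∀ a : A, Commute (incl a) q₁)
    (h01 : q₁ * q = 0) (h12 : q₁ * q₂ = 0) {a : A} (ha : a ∈ I) (haq : incl a * q ≠ 0) :
    2 ≤ ‖restrictIdeal σ I hI - innerAut u‖ := by
  have hσI : ∀ {x : A}, x ∈ I → σ x ∈ I := fun hx => hI σ (Subgroup.mem_zpowers σ) _ hx
  -- Passing from `a` to `h = a* a` makes `h` self-adjoint and keeps `h q ≠ 0`.
  set h : A := star a * a with hh
  have hhI : h ∈ I := I.mul_mem_left _ ha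
  have hsa : star h = h := by rw [hh, star_mul, star_star]
  have hhq : incl h * q ≠ 0 := by
    intro h0
    refine haq (CStarRing.star_mul_self_eq_zero_iff _ |>.1 ?_)
    rw [star_mul, hq.isSelfAdjoint.star_eq, ← incl_star, mul_assoc, ← mul_assoc (incl (star a)),
      ← incl_mul, ← hh, h0, mul_zero]
  let c : I := ⟨h, hhI⟩
  let b : I := ⟨σ h, hσI hhI⟩
  have hb : star b = b := Subtype.ext (by
    change star (σ h) = σ h
    rw [← map_star, hsa])
  -- `f = u* σ(h)` and `e = σ(h) u`, so that `e = f*`.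
  let f : I := (star (u : 𝓜(ℂ, I))).fst b
  let e : I := (u : 𝓜(ℂ, I)).snd b
  have hf : f = star e := by
    change (star (u : 𝓜(ℂ, I))).fst b = star ((u : 𝓜(ℂ, I)).snd b)
    rw [DoubleCentralizer.star_fst, hb]
  have hef : e * f = b * b := by
    change (u : 𝓜(ℂ, I)).snd b * (star (u : 𝓜(ℂ, I))).fst b = b * b
    rw [DoubleCentralizer.central, unitary_fst_star_fst]
  have hfA : (f : A) = star (e : A) := congrArg Subtype.val hf
  have hefA : (e : A) * f = σ h * σ h := congrArg Subtype.val hef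
  have key := norm_bidual_sub_innerAut_le σ I hI u c c f e q q₁
  rw [hq₁, hq₂] at key
  have huf : (u : 𝓜(ℂ, I)).fst f = b := unitary_fst_star_fst u b
  have hue : (star (u : 𝓜(ℂ, I))).snd e = b := unitary_star_snd_snd u b
  rw [huf, hue] at key
  set m : ℝ := ‖q * incl (h * h)‖ with hm
  have hqq : q * q = q := hq.isIdempotentElem.eq
  have hqq' : q₁ * q₁ = q₁ := hq'.isIdempotentElem.eq
  have hcut : ∀ x y : A, incl x * q * incl y = q * incl (x * y) := fun x y => by
    rw [(hc x).eq, mul_assoc, incl_mul]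
  have hcut₁ : ∀ x y : A, incl x * q₁ * incl y = q₁ * incl (x * y) := fun x y => by
    rw [(hc₁ x).eq, mul_assoc, incl_mul]
  have hm0 : 0 < m := by
    have h1 : star (incl h * q) * (incl h * q) = q * incl (h * h) := by
      rw [star_mul, hq.isSelfAdjoint.star_eq, ← incl_star, hsa, mul_assoc, ← mul_assoc (incl h),
        ← incl_mul, (hc _).eq, ← mul_assoc, hqq]
    rw [hm, ← h1, CStarRing.norm_star_mul_self]
    exact mul_pos (norm_pos_iff.2 hhq) (norm_pos_iff.2 hhq)
  have hm₁ : ‖q₁ * incl (σ h * σ h)‖ = m := by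
    have h1 : q₁ * incl (σ h * σ h) = bidualMap (SeqAlg.map (autCLM σ)) (q * incl (h * h)) := by
      rw [bidualMap_mul (SeqAlg.map_mul fun a b => map_mul σ a b), hq₁, ← map_mul]
      rfl
    rw [h1, norm_bidualMap_of_isometry (SeqAlg.norm_map_of_isometry (norm_autCLM_apply σ))]
  -- Both halves of the test element have norm `m`, and they are orthogonal.
  have hx0 : ‖incl h * q * incl h‖ ≤ m := by rw [hcut]
  have hx1 : ‖incl (f : A) * q₁ * incl (e : A)‖ ≤ m := by
    have h1 : incl (f : A) * q₁ * incl (e : A)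
        = star (q₁ * incl (e : A)) * (q₁ * incl (e : A)) := by
      rw [star_mul, hq'.isSelfAdjoint.star_eq, ← incl_star, ← hfA, mul_assoc, mul_assoc,
        ← mul_assoc q₁ q₁, hqq']
    have h2 : (q₁ * incl (e : A)) * star (q₁ * incl (e : A)) = q₁ * incl (σ h * σ h) := by
      rw [star_mul, hq'.isSelfAdjoint.star_eq, ← incl_star, ← hfA, mul_assoc,
        ← mul_assoc (incl (e : A)), ← incl_mul, hefA, (hc₁ _).eq, ← mul_assoc, hqq']
    rw [h1, CStarRing.norm_star_mul_self, ← CStarRing.norm_self_mul_star, h2, hm₁]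
  have hself0 : IsSelfAdjoint (incl h * q * incl h) := by
    rw [isSelfAdjoint_iff, star_mul, star_mul, hq.isSelfAdjoint.star_eq, ← incl_star, hsa,
      mul_assoc]
  have hself1 : IsSelfAdjoint (-(incl (f : A) * q₁ * incl (e : A))) := by
    rw [isSelfAdjoint_iff, star_neg, star_mul, star_mul, hq'.isSelfAdjoint.star_eq, hfA, incl_star,
      star_star, mul_assoc]
  have h10 : q * q₁ = 0 := by
    rw [← hq.isSelfAdjoint.star_eq, ← hq'.isSelfAdjoint.star_eq, ← star_mul, h01, star_zero]
  have horth : (incl h * q * incl h) * -(incl (f : A) * q₁ * incl (e : A)) = 0 := by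
    rw [mul_neg, hcut, hcut₁, ← (hc _).eq, mul_assoc, ← mul_assoc q, h10, zero_mul, mul_zero,
      neg_zero]
  have hx : ‖incl h * q * incl h - incl (f : A) * q₁ * incl (e : A)‖ ≤ m := by
    rw [sub_eq_add_neg]
    exact norm_add_le_of_mul_eq_zero hself0 hself1 horth hx0 (by rwa [norm_neg])
  -- Cutting the image down by `q₁` leaves two equal terms that add up.
  have hcutq : ∀ (z : Bidual (SeqAlg A)) (x y : A), q₁ * z = 0 → q₁ * (incl x * z * incl y) = 0 :=
    fun z x y hz => by
      rw [mul_assoc, ← mul_assoc q₁, ← (hc₁ x).eq, mul_assoc, ← mul_assoc q₁ z, hz, zero_mul,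
        mul_zero]
  have hcutq₁ : ∀ x y : A, q₁ * (incl x * q₁ * incl y) = q₁ * incl (x * y) := fun x y => by
    rw [hcut₁, ← mul_assoc, hqq']
  have hZ : 2 * m ≤ ‖restrictIdeal σ I hI - innerAut u‖ * m := by
    refine le_trans ?_ (key.trans (mul_le_mul_of_nonneg_left hx (norm_nonneg _)))
    refine le_trans ?_ ((norm_mul_le q₁ _).trans (mul_le_of_le_one_left (norm_nonneg _)
      (norm_le_one_of_isStarProjection hq')))
    rw [mul_sub, mul_sub, mul_sub, hcutq q _ _ h01, hcutq q₂ _ _ h12, hcutq₁, sub_zero,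
      zero_sub, sub_neg_eq_add]
    change 2 * m ≤ ‖q₁ * incl (σ h * σ h) + q₁ * incl (σ h * σ h)‖
    rw [← two_smul ℝ, norm_smul, hm₁]
    simp
  exact le_of_mul_le_mul_right hZ hm0

end Main

end RokhlinStar

theorem theorem2p19 {G : Type*} [Group G] {A : Type*} [NonUnitalCStarAlgebra A]
    (α : G →* (A ≃⋆ₐ[ℂ] A)) (hα : RokhlinStar.HasRokhlinStar α) :
    RokhlinStar.IsProperlyOuter α := by
  obtain ⟨p, hp, hcomm, horth, hfull⟩ := hα
  rintro t ht I hI ⟨a, haI, ha⟩ u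
  refine le_antisymm ?_ ?_
  · refine (norm_sub_le _ _).trans ?_
    linarith [RokhlinStar.norm_restrictIdeal_le I (α t) hI, RokhlinStar.norm_innerAut_le u]
  · obtain ⟨s, hs⟩ := hfull a ha
    refine RokhlinStar.two_le_norm_sub_innerAut (α t) I hI u
      (RokhlinStar.bidualAct_bidualAct α t s p) (RokhlinStar.bidualAct_bidualAct α t (t * s) p)
      (RokhlinStar.isStarProjection_bidualAct α hp s)
      (RokhlinStar.isStarProjection_bidualAct α hp (t * s))
      (RokhlinStar.commute_bidualAct α hcomm s) (RokhlinStar.commute_bidualAct α hcomm (t * s))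
      (RokhlinStar.bidualAct_mul_bidualAct_eq_zero α horth ?_)
      (RokhlinStar.bidualAct_mul_bidualAct_eq_zero α horth ?_) haI hs
    · simpa using ht
    · simpa using ht
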